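/- Call a function $\varphi:\mathbb R\to(0,\infty)$ an admissible weight if it is locally absolutely continuous, if there is $A>0$ with $|\varphi'(x)|\le A|\varphi(x)|$ for almost every $x$, and if there are a function $v:\mathbb R\to\mathbb R$ and a constant $c>0$ such that $v(x+y)\le v(x)v(y)$ and $\varphi(x+y)\le c\,v(x)\varphi(y)$ for all $x,y\in\mathbb R$, $\inf_{\mathbb R} v>0$, and $\int_{\mathbb R}v(x)e^{-|x|}\,dx<\infty$. Let $H^s=H^s(\mathbb R)$ denote the $L_2$-based Sobolev space of real functions and $\|\cdot\|_p$ the norm of $L_p(\mathbb R)$. Theorem. For every admissible weight $\varphi$ there is a constant $C>0$, depending only on $\varphi$, such that the following holds. Let $s>3$, $2\le p\le\infty$ and $0<T\le\infty$, and let $$z=(u,\rho)\in C([0,T);H^s\times H^{s-1})\cap C^1([0,T);H^{s-1}\times H^{s-2})$$ be a strong solution of the two-component Camassa–Holm system $$u_t-u_{txx}=uu_{xxx}+2u_xu_{xx}-3uu_x-\rho\rho_x,\qquad \rho_t=-(\rho u)_x$$ (for every $t\in[0,T)$ the equations hold for almost every $x$, the derivatives in $x$ being weak derivatives), with initial value $(u_0,\rho_0)=z(0)$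 such that $\varphi u_0,\ \varphi u_{0x},\ \varphi u_{0xx},\ \varphi\rho_0,\ \varphi\rho_{0x}\in L_p(\mathbb R)$. Let $$M:=\sup_{t\in[0,T)}\left\{\|u(t)\|_\infty+\|u_x(t)\|_\infty+\|u_{xx}(t)\|_\infty+\|\rho(t)\|_\infty+\|\rho_x(t)\|_\infty\right\}\in[0,\infty].$$ Then, for all $t\in[0,T)$, $$\|\varphi u(t)\|_p+\|\varphi u_x(t)\|_p+\|\varphi u_{xx}(t)\|_p+\|\varphi\rho(t)\|_p+\|\varphi\rho_x(t)\|_p$$ $$\le e^{CMt}\left(\|\varphi u_0\|_p+\|\varphi u_{0x}\|_p+\|\varphi u_{0xx}\|_p+\|\varphi\rho_0\|_p+\|\varphi\rho_{0x}\|_p\right),$$ with the conventions $\infty\cdot 0=0$ and $e^{\infty}=\infty$ if $M=\infty$. -/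

import Mathlib

open MeasureTheory Filter Topology
open scoped ENNReal FourierTransform

noncomputable section

namespace TwoCH

/-- The norm of the Sobolev space `H^s(ℝ)`, `s ≥ 0`, of a real function:
the square root of `∫ |û(y)|² (1 + y²)^s dy` with `û(y) = (2π)^(-1/2) ∫ u(x) e^(-ixy) dx`, written
after the substitution `y = 2πξ` in terms of the Plancherel transform `𝓕` on `L²`, which has the
kernel `e^(-2πixξ)`. It is `∞` outside `L²`. -/
def sobolevNorm (s : ℝ) (f : ℝ → ℝ) : ℝ≥0∞ :=
  open Classical in
  if hf : MemLp (fun x => (f x : ℂ)) 2 (volume : Measure ℝ) then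
    (∫⁻ ξ : ℝ, ENNReal.ofReal ((1 + (2 * Real.pi * ξ) ^ 2) ^ s) *
      ‖(𝓕 (hf.toLp (fun x => (f x : ℂ))) : Lp ℂ 2 (volume : Measure ℝ)) ξ‖ₑ ^ 2) ^ (1 / 2 : ℝ)
  else ∞

/-- `f ∈ H^s(ℝ)`. -/
def MemHs (s : ℝ) (f : ℝ → ℝ) : Prop := sobolevNorm s f < ∞

/-- The time interval `[0, T)`, where `T = ∞` is allowed. -/
def timeInterval (T : EReal) : Set ℝ := {t : ℝ | 0 ≤ t ∧ (t : EReal) < T}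

/-- `w ∈ C(I; H^s)`; every `w t` is given by its continuous representative. -/
structure ContHs (I : Set ℝ) (s : ℝ) (w : ℝ → ℝ → ℝ) : Prop where
  continuous : ∀ t ∈ I, Continuous (w t)
  mem : ∀ t ∈ I, MemHs s (w t)
  tendsto : ∀ t₀ ∈ I, Tendsto (fun t => sobolevNorm s (fun x => w t x - w t₀ x)) (𝓝[I] t₀) (𝓝 0)

/-- `w` is differentiable on `I` with respect to the norm of `H^s`, with derivative `w'`
(one-sided at an end point that belongs to `I`), and `w' ∈ C(I; H^s)`. -/
structure HasContDerivHs (I : Set ℝ) (s : ℝ) (w w' : ℝ → ℝ → ℝ) : Prop where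
  cont : ContHs I s w
  cont_deriv : ContHs I s w'
  tendsto : ∀ t₀ ∈ I, Tendsto
    (fun t => sobolevNorm s (fun x => (t - t₀)⁻¹ * (w t x - w t₀ x) - w' t₀ x))
    (𝓝[I \ {t₀}] t₀) (𝓝 0)

/-- `(u, ρ) ∈ C([0,T); H^s × H^(s-1)) ∩ C¹([0,T); H^(s-1) × H^(s-2))` is a strong solution of the
two-component Camassa-Holm system. For `s > 3` both sides of the first equation are in `L²`, and
the equations hold almost everywhere in `x`, at each time. The derivatives `u_xxx` and `u_txx` are
those of the locally absolutely continuous functions `u_xx` and `u_tx`, which exist almost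
everywhere and are the weak derivatives. -/
structure IsStrongSolution (s : ℝ) (T : EReal) (u ρ : ℝ → ℝ → ℝ) : Prop where
  cont_u : ContHs (timeInterval T) s u
  cont_ρ : ContHs (timeInterval T) (s - 1) ρ
  equations : ∃ ut ρt : ℝ → ℝ → ℝ,
    HasContDerivHs (timeInterval T) (s - 1) u ut ∧
    HasContDerivHs (timeInterval T) (s - 2) ρ ρt ∧
    ∀ t ∈ timeInterval T,
      (∀ᵐ x : ℝ, ut t x - iteratedDeriv 2 (ut t) x =
        u t x * iteratedDeriv 3 (u t) x + 2 * deriv (u t) x * iteratedDeriv 2 (u t) x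
          - 3 * u t x * deriv (u t) x - ρ t x * deriv (ρ t) x) ∧
      (∀ᵐ x : ℝ, ρt t x = - deriv (fun y => ρ t y * u t y) x)

/-- `v` is sub-multiplicative. -/
def IsSubmultiplicative (v : ℝ → ℝ) : Prop := ∀ x y, v (x + y) ≤ v x * v y

/-- The positive function `φ` is `v`-moderate. -/
def IsModerate (v φ : ℝ → ℝ) : Prop := ∃ c : ℝ, 0 < c ∧ ∀ x y, φ (x + y) ≤ c * v x * φ y

/-- `φ` is an admissible weight function for the two-component Camassa-Holm equation. -/
structure IsAdmissible (φ : ℝ → ℝ) : Prop where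
  pos : ∀ x, 0 < φ x
  locallyAbsolutelyContinuous : ∀ a b, AbsolutelyContinuousOnInterval φ a b
  deriv_le : ∃ A : ℝ, 0 < A ∧ ∀ᵐ x : ℝ, |deriv φ x| ≤ A * |φ x|
  moderate : ∃ v : ℝ → ℝ, IsSubmultiplicative v ∧ IsModerate v φ ∧
    (∃ δ : ℝ, 0 < δ ∧ ∀ x, δ ≤ v x) ∧
    Integrable (fun x => v x * Real.exp (-|x|)) (volume : Measure ℝ)

/-- `‖φ f‖_p + ‖φ f_x‖_p + ‖φ f_xx‖_p + ‖φ g‖_p + ‖φ g_x‖_p`. -/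
def weightedNorm (φ : ℝ → ℝ) (p : ℝ≥0∞) (f g : ℝ → ℝ) : ℝ≥0∞ :=
  eLpNorm (fun x => φ x * f x) p volume + eLpNorm (fun x => φ x * deriv f x) p volume +
    eLpNorm (fun x => φ x * iteratedDeriv 2 f x) p volume +
    eLpNorm (fun x => φ x * g x) p volume + eLpNorm (fun x => φ x * deriv g x) p volume

/-- `M = sup_{t ∈ [0,T)} (‖u(t)‖_∞ + ‖u_x(t)‖_∞ + ‖u_xx(t)‖_∞ + ‖ρ(t)‖_∞ + ‖ρ_x(t)‖_∞)`,
a number in `[0, ∞]`. -/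
def supBound (T : EReal) (u ρ : ℝ → ℝ → ℝ) : ℝ≥0∞ :=
  ⨆ t ∈ timeInterval T,
    (eLpNorm (u t) ∞ volume + eLpNorm (deriv (u t)) ∞ volume +
      eLpNorm (iteratedDeriv 2 (u t)) ∞ volume +
      eLpNorm (ρ t) ∞ volume + eLpNorm (deriv (ρ t)) ∞ volume)

end TwoCH

end

/-!
The proof is an energy estimate for the five functions `u, u_x, u_xx, ρ, ρ_x`. Each solves a transport equation
`f_t = -u f_x + g`. To see that `g` is of order zero in these functions, put `b = u_t + u u_x` and
`F = u² + u_x²/2 + ρ²/2`: the first equation of the system is `b - b_xx = -F_x`, so `m = b_x - F` satisfies `m_x = b`,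
`b_x = m + F`, whence `|b|` and `|m|` are at most `½ e^(-|·|) * F`, and `F ≤ M S` with `S` the sum of the absolute values
of the five functions (`ofReal_abs_le_of_elliptic`, `forcing_isControlled`). A moderate weight passes through this
convolution, so `‖φ g‖_q ≤ (6 + κ) M ‖φ S‖_q`, where `κ` is a multiple of `∫ v(x) e^(-|x|) dx` (`eLpNorm_weighted_le`).

Suppose first that `φ` is bounded and `2 ≤ q < ∞`. The function `‖φ f(t)‖_q` need not be differentiable in `t`, but by
convexity of the norm its differences to the past are bounded by the pairing of `f(t) - f(t - h)` with
`|φ f|^(q-2) φ f`. That function is in `L²`, so differentiability in time with values in `L²` is enough, and the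
transport term is integrated by parts, using `|φ'| ≤ A φ`; here all functions of `x` are absolutely continuous only
(`eventually_slope_lt`). Grönwall's inequality for left Dini derivatives gives the estimate, with
`C = A + 1 + 5 (6 + κ)` (`sum_le_exp_mul_sum`, `IsStrongSolution.sum_toReal_le`).

As `C` does not depend on `q`, the limit `q → ∞` gives `p = ∞`. As it is the same for all the truncations `min(φ, N)`,
which have the same `A` and are `v`-moderate with a common constant, Fatou's lemma gives the
estimate for `φ`. On `[0, t]` the five functions are bounded by a finite number not exceeding `M`, because they are
continuous in time with values in `L^∞`; so `M = ∞` needs no separate treatment.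

The link between the definition of `H^s` and calculus is that `f ∈ H^s`, `s ≥ 1`, has an absolutely continuous
representative whose derivative is in `H^(s-1)` (`MemHs.absolutelyContinuous_and_deriv_le`). It is
shown by approximating `f` and the inverse Fourier transform of `2πiξ f̂` by Schwartz functions and their derivatives.
-/

namespace TwoCH

/-! ### Weak derivatives and the Fourier transform on `L²` -/

theorem schwartzMap_sub_eq_integral (f : SchwartzMap ℝ ℂ) (a b : ℝ) :
    f b - f a = ∫ x in a..b, SchwartzMap.derivCLM ℂ ℂ f x := by
  have h : ∀ x ∈ Set.uIcc a b, HasDerivAt f (SchwartzMap.derivCLM ℂ ℂ f x) x := fun x _ => by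
    rw [SchwartzMap.derivCLM_apply]
    exact f.differentiableAt.hasDerivAt
  exact (intervalIntegral.integral_eq_sub_of_hasDerivAt h
    ((SchwartzMap.derivCLM ℂ ℂ f).continuous.intervalIntegrable a b)).symm

theorem fourier_schwartzMap_deriv (f : SchwartzMap ℝ ℂ) (ξ : ℝ) :
    𝓕 (SchwartzMap.derivCLM ℂ ℂ f) ξ = (2 * Real.pi * Complex.I * ξ) * 𝓕 f ξ := by
  have : (SchwartzMap.derivCLM ℂ ℂ f : ℝ → ℂ) = deriv f := by ext x; simp
  have h := Real.fourier_deriv (f := f) f.integrable f.differentiable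
    (this ▸ (SchwartzMap.derivCLM ℂ ℂ f).integrable)
  rw [SchwartzMap.fourier_coe, SchwartzMap.fourier_coe, this]
  simpa using congrFun h ξ

/-- Integration over a bounded interval is an inner product with an indicator function, hence continuous
on `L²`. -/
theorem tendsto_intervalIntegral_Lp {g : ℕ → Lp ℂ 2 (volume : Measure ℝ)} {g₀ : Lp ℂ 2 (volume : Measure ℝ)}
    (h : Tendsto g atTop (𝓝 g₀)) (a b : ℝ) :
    Tendsto (fun n => ∫ x in a..b, g n x) atTop (𝓝 (∫ x in a..b, g₀ x)) := by
  have key : ∀ a b : ℝ, Tendsto (fun n => ∫ x in Set.Ioc a b, g n x) atTop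
      (𝓝 (∫ x in Set.Ioc a b, g₀ x)) := by
    intro a b
    have := ((innerSL ℂ (indicatorConstLp 2 (measurableSet_Ioc (a := a) (b := b))
      (by simp : (volume : Measure ℝ) (Set.Ioc a b) ≠ ∞) (1 : ℂ))).continuous.tendsto g₀).comp h
    simpa [Function.comp_def, L2.inner_indicatorConstLp_one] using this
  simp only [intervalIntegral]
  exact (key a b).sub (key b a)

theorem Lp_fourier_sub (f g : Lp ℂ 2 (volume : Measure ℝ)) : 𝓕 (f - g) = 𝓕 f - 𝓕 g :=
  (Lp.fourierTransformₗᵢ ℝ ℂ).map_sub f g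

/-- If the Fourier transform of `g` is `2πiξ` times that of `f`, then Schwartz functions approximate `f`
in `L²` so that their derivatives approximate `g`. On the Fourier side, approximate `(1 + ξ²)^(1/2) f̂`
and divide by `(1 + ξ²)^(1/2)`; both `f̂` and `2πiξ f̂` are bounded multiples of that function. -/
theorem exists_schwartz_approx (f g : Lp ℂ 2 (volume : Measure ℝ))
    (hf : MemLp (fun ξ : ℝ => (((1 + ‖ξ‖ ^ 2) ^ (1 / 2 : ℝ) : ℝ) : ℂ) * (𝓕 f : Lp ℂ 2 (volume : Measure ℝ)) ξ) 2 volume)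
    (hg : (𝓕 g : Lp ℂ 2 (volume : Measure ℝ)) =ᵐ[volume]
      fun ξ => (2 * Real.pi * Complex.I * ξ) * (𝓕 f : Lp ℂ 2 (volume : Measure ℝ)) ξ) :
    ∃ F : ℕ → SchwartzMap ℝ ℂ, Tendsto (fun n => (F n).toLp 2 volume) atTop (𝓝 f) ∧
      Tendsto (fun n => (SchwartzMap.derivCLM ℂ ℂ (F n)).toLp 2 volume) atTop (𝓝 g) := by
  obtain ⟨y, hy, hlim⟩ := mem_closure_iff_seq_limit.1
    ((SchwartzMap.denseRange_toLpCLM (E := ℝ) (F := ℂ) (p := 2) (μ := volume) (by simp)) (hf.toLp _))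
  choose H hH using hy
  set m : ℝ → ℝ := fun ξ => (1 + ‖ξ‖ ^ 2) ^ (-(1 / 2) : ℝ) with hm
  have hmg : m.HasTemperateGrowth := by fun_prop
  have hm_nonneg : ∀ ξ, 0 ≤ m ξ := fun ξ => by positivity
  have hm_le : ∀ ξ, m ξ ≤ 1 := fun ξ =>
    Real.rpow_le_one_of_one_le_of_nonpos (by nlinarith [sq_nonneg ‖ξ‖]) (by norm_num)
  have hm_mul : ∀ ξ, m ξ * ‖ξ‖ ≤ 1 := fun ξ => by
    have h1 : ‖ξ‖ ≤ (1 + ‖ξ‖ ^ 2) ^ (1 / 2 : ℝ) := by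
      rw [← Real.sqrt_eq_rpow]; exact Real.le_sqrt_of_sq_le (by linarith)
    have h2 : m ξ * (1 + ‖ξ‖ ^ 2) ^ (1 / 2 : ℝ) = 1 := by
      rw [hm, ← Real.rpow_add (by positivity)]; simp
    calc m ξ * ‖ξ‖ ≤ m ξ * (1 + ‖ξ‖ ^ 2) ^ (1 / 2 : ℝ) :=
          mul_le_mul_of_nonneg_left h1 (hm_nonneg ξ)
      _ = 1 := h2
  set F : ℕ → SchwartzMap ℝ ℂ := fun n => 𝓕⁻ (SchwartzMap.smulLeftCLM ℂ m (H n)) with hF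
  have hFF : ∀ n ξ, 𝓕 (F n) ξ = m ξ * H n ξ := by
    intro n ξ
    rw [hF]; simp [SchwartzMap.smulLeftCLM_apply_apply hmg]
  have hcoe : ∀ n, (y n : ℝ → ℂ) =ᵐ[volume] H n := fun n => by
    rw [← hH n]; exact SchwartzMap.coeFn_toLp _ _ _
  have hfm : (hf.toLp _ : ℝ → ℂ) =ᵐ[volume] _ := hf.coeFn_toLp
  have hfe : ∀ᵐ ξ : ℝ, (𝓕 f : Lp ℂ 2 (volume : Measure ℝ)) ξ = m ξ * hf.toLp _ ξ := by
    filter_upwards [hfm] with ξ h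
    rw [h, ← mul_assoc, ← Complex.ofReal_mul, hm, ← Real.rpow_add (by positivity)]; simp
  have hd : Tendsto (fun n => ‖y n - hf.toLp _‖) atTop (𝓝 0) :=
    tendsto_iff_norm_sub_tendsto_zero.1 hlim
  refine ⟨F, ?_, ?_⟩
  · rw [tendsto_iff_norm_sub_tendsto_zero]
    refine squeeze_zero (fun _ => norm_nonneg _) (fun n => ?_) hd
    rw [← Lp.norm_fourier_eq, Lp_fourier_sub, SchwartzMap.toLp_fourier_eq]
    refine Lp.norm_le_norm_of_ae_le ?_
    filter_upwards [hfe, Lp.coeFn_sub ((𝓕 (F n)).toLp 2 volume) (𝓕 f), Lp.coeFn_sub (y n) (hf.toLp _),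
      SchwartzMap.coeFn_toLp (𝓕 (F n)) 2 volume, hcoe n] with ξ h1 h2 h3 h4 h5
    rw [h2, h3, Pi.sub_apply, Pi.sub_apply, h4, h5, h1, hFF, ← mul_sub, norm_mul]
    rw [Complex.norm_real, Real.norm_of_nonneg (hm_nonneg ξ)]
    exact mul_le_of_le_one_left (norm_nonneg _) (hm_le ξ)
  · rw [tendsto_iff_norm_sub_tendsto_zero]
    refine squeeze_zero (fun _ => norm_nonneg _) (fun n => ?_)
      (by have := hd.const_mul (2 * Real.pi); rwa [mul_zero] at this)
    rw [← Lp.norm_fourier_eq, Lp_fourier_sub, SchwartzMap.toLp_fourier_eq]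
    refine Lp.norm_le_mul_norm_of_ae_le_mul ?_
    filter_upwards [hfe, Lp.coeFn_sub ((𝓕 (SchwartzMap.derivCLM ℂ ℂ (F n))).toLp 2 volume) (𝓕 g),
      Lp.coeFn_sub (y n) (hf.toLp _), hg,
      SchwartzMap.coeFn_toLp (𝓕 (SchwartzMap.derivCLM ℂ ℂ (F n))) 2 volume, hcoe n]
      with ξ h1 h2 h3 h6 h4 h5
    rw [h2, h3, Pi.sub_apply, Pi.sub_apply, h4, h5, h6, h1, fourier_schwartzMap_deriv, hFF,
      ← mul_sub, ← mul_sub]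
    have : ‖(2 * Real.pi * Complex.I * ξ : ℂ)‖ = 2 * Real.pi * ‖ξ‖ := by
      simp [abs_of_pos Real.pi_pos]
    rw [norm_mul (2 * Real.pi * Complex.I * ξ : ℂ), norm_mul (m ξ : ℂ), this, Complex.norm_real,
      Real.norm_of_nonneg (hm_nonneg ξ), ← mul_assoc]
    refine mul_le_mul_of_nonneg_right ?_ (norm_nonneg _)
    rw [mul_assoc]
    calc 2 * Real.pi * (‖ξ‖ * m ξ) ≤ 2 * Real.pi * 1 := by
          gcongr; rw [mul_comm]; exact hm_mul ξ
      _ = 2 * Real.pi := mul_one _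

/-- A function of `L²` whose Fourier transform is `2πiξ f̂` is the weak derivative of `f`, in the form of
the fundamental theorem of calculus between almost all points. -/
theorem exists_weakDeriv (f g : Lp ℂ 2 (volume : Measure ℝ))
    (hf : MemLp (fun ξ : ℝ => (((1 + ‖ξ‖ ^ 2) ^ (1 / 2 : ℝ) : ℝ) : ℂ) * (𝓕 f : Lp ℂ 2 (volume : Measure ℝ)) ξ) 2 volume)
    (hg : (𝓕 g : Lp ℂ 2 (volume : Measure ℝ)) =ᵐ[volume]
      fun ξ => (2 * Real.pi * Complex.I * ξ) * (𝓕 f : Lp ℂ 2 (volume : Measure ℝ)) ξ) :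
    ∃ S : Set ℝ, (∀ᵐ x, x ∈ S) ∧ ∀ a ∈ S, ∀ b ∈ S, f b - f a = ∫ x in a..b, g x := by
  obtain ⟨F, hF, hF'⟩ := exists_schwartz_approx f g hf hg
  obtain ⟨ns, hns, hae⟩ := (tendstoInMeasure_of_tendsto_Lp hF).exists_seq_tendsto_ae
  have hall : ∀ᵐ x : ℝ, ∀ n, ((F (ns n)).toLp 2 volume : ℝ → ℂ) x = F (ns n) x :=
    ae_all_iff.2 fun n => SchwartzMap.coeFn_toLp _ _ _
  -- the set where a subsequence of the Schwartz approximations converges to `f`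
  refine ⟨{x | Tendsto (fun n => F (ns n) x) atTop (𝓝 (f x))}, ?_, ?_⟩
  · filter_upwards [hae, hall] with x h1 h2
    simpa [h2] using h1
  · intro a ha b hb
    have h1 := Tendsto.sub (show Tendsto _ _ _ from hb) (show Tendsto _ _ _ from ha)
    have h2 := (tendsto_intervalIntegral_Lp hF' a b).comp hns.tendsto_atTop
    refine tendsto_nhds_unique h1 (h2.congr fun n => ?_)
    rw [schwartzMap_sub_eq_integral]
    refine intervalIntegral.integral_congr_ae ?_
    filter_upwards [SchwartzMap.coeFn_toLp (SchwartzMap.derivCLM ℂ ℂ (F (ns n))) 2 volume] with x hx _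
    exact hx

/-! ### Sobolev spaces -/

theorem sobolevNorm_eq (s : ℝ) {f : ℝ → ℝ} (hf : MemLp (fun x => (f x : ℂ)) 2 volume) :
    sobolevNorm s f = (∫⁻ ξ : ℝ, ENNReal.ofReal ((1 + (2 * Real.pi * ξ) ^ 2) ^ s) *
      ‖(𝓕 (hf.toLp (fun x => (f x : ℂ))) : Lp ℂ 2 (volume : Measure ℝ)) ξ‖ₑ ^ 2) ^ (1 / 2 : ℝ) := by
  rw [sobolevNorm, dif_pos hf]

theorem MemHs.memLp {s : ℝ} {f : ℝ → ℝ} (h : MemHs s f) :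
    MemLp (fun x => (f x : ℂ)) 2 volume := by
  by_contra hf
  rw [MemHs, sobolevNorm, dif_neg hf] at h
  exact lt_irrefl _ h

theorem eLpNorm_two_eq (g : ℝ → ℂ) :
    eLpNorm g 2 volume = (∫⁻ ξ, ‖g ξ‖ₑ ^ 2) ^ (1 / 2 : ℝ) := by
  rw [eLpNorm_eq_lintegral_rpow_enorm_toReal (by norm_num) (by norm_num)]
  simp

theorem eLpNorm_le_sobolevNorm {s : ℝ} (hs : 0 ≤ s) (f : ℝ → ℝ) :
    eLpNorm f 2 volume ≤ sobolevNorm s f := by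
  by_cases hf : MemLp (fun x => (f x : ℂ)) 2 volume
  · have h1 : eLpNorm f 2 volume = eLpNorm (fun x => (f x : ℂ)) 2 volume :=
      eLpNorm_congr_norm_ae (by simp)
    rw [h1, ← Lp.enorm_toLp hf, ← ofReal_norm, ← Lp.norm_fourier_eq, ofReal_norm, Lp.enorm_def,
      eLpNorm_two_eq, sobolevNorm_eq s hf]
    refine ENNReal.rpow_le_rpow (lintegral_mono fun ξ => ?_) (by norm_num)
    refine le_mul_of_one_le_left zero_le ?_
    rw [← ENNReal.ofReal_one]
    exact ENNReal.ofReal_le_ofReal (Real.one_le_rpow (by nlinarith [sq_nonneg (2 * Real.pi * ξ)]) hs)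
  · rw [sobolevNorm, dif_neg hf]; exact le_top

theorem MemHs.lintegral_lt_top {s : ℝ} {f : ℝ → ℝ} (h : MemHs s f) :
    ∫⁻ ξ : ℝ, ENNReal.ofReal ((1 + (2 * Real.pi * ξ) ^ 2) ^ s) *
      ‖(𝓕 (h.memLp.toLp (fun x => (f x : ℂ))) : Lp ℂ 2 (volume : Measure ℝ)) ξ‖ₑ ^ 2 < ∞ := by
  have := h
  rw [MemHs, sobolevNorm_eq s h.memLp] at this
  by_contra hcon
  rw [not_lt, top_le_iff] at hcon
  rw [hcon] at this
  simp at this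

/-- A Fourier multiplier with `|m(ξ)|² ≤ 1 + (2πξ)²` costs one order of regularity. -/
theorem ofReal_mul_enorm_sq_le {r s : ℝ} {m : ℂ} {ξ : ℝ}
    (hm : ‖m‖ ^ 2 ≤ 1 + (2 * Real.pi * ξ) ^ 2) (hrs : r + 1 ≤ s) (z : ℂ) :
    ENNReal.ofReal ((1 + (2 * Real.pi * ξ) ^ 2) ^ r) * ‖m * z‖ₑ ^ 2 ≤
      ENNReal.ofReal ((1 + (2 * Real.pi * ξ) ^ 2) ^ s) * ‖z‖ₑ ^ 2 := by
  have h1 : (1 : ℝ) ≤ 1 + (2 * Real.pi * ξ) ^ 2 := by nlinarith [sq_nonneg (2 * Real.pi * ξ)]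
  rw [enorm_mul, mul_pow ‖m‖ₑ, ← mul_assoc]
  refine mul_le_mul_left ?_ _
  rw [← ofReal_norm, ← ENNReal.ofReal_pow (norm_nonneg _), ← ENNReal.ofReal_mul (by positivity)]
  refine ENNReal.ofReal_le_ofReal ?_
  calc (1 + (2 * Real.pi * ξ) ^ 2) ^ r * ‖m‖ ^ 2
      ≤ (1 + (2 * Real.pi * ξ) ^ 2) ^ r * (1 + (2 * Real.pi * ξ) ^ 2) := by gcongr
    _ = (1 + (2 * Real.pi * ξ) ^ 2) ^ (r + 1) := by
        rw [Real.rpow_add (by positivity), Real.rpow_one]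
    _ ≤ _ := Real.rpow_le_rpow_of_exponent_le h1 hrs

theorem MemHs.memLp_mul {s : ℝ} (hs : 1 ≤ s) {f : ℝ → ℝ} (h : MemHs s f) {m : ℝ → ℂ}
    (hm : Continuous m) (hm' : ∀ ξ, ‖m ξ‖ ^ 2 ≤ 1 + (2 * Real.pi * ξ) ^ 2) :
    MemLp (fun ξ => m ξ * (𝓕 (h.memLp.toLp (fun x => (f x : ℂ))) : Lp ℂ 2 (volume : Measure ℝ)) ξ)
      2 volume := by
  refine ⟨hm.aestronglyMeasurable.mul (Lp.aestronglyMeasurable _), ?_⟩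
  rw [eLpNorm_two_eq]
  refine ENNReal.rpow_lt_top_of_nonneg (by norm_num) (ne_of_lt ?_)
  refine lt_of_le_of_lt (lintegral_mono fun ξ => ?_) h.lintegral_lt_top
  have := ofReal_mul_enorm_sq_le (hm' ξ) (r := 0) (s := s) (by linarith)
    ((𝓕 (h.memLp.toLp (fun x => (f x : ℂ))) : Lp ℂ 2 (volume : Measure ℝ)) ξ)
  simpa using this

theorem Lp_locallyIntegrable (g : Lp ℂ 2 (volume : Measure ℝ)) : LocallyIntegrable g volume :=
  (Lp.memLp g).locallyIntegrable (by norm_num)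

theorem Lp_intervalIntegrable (g : Lp ℂ 2 (volume : Measure ℝ)) (a b : ℝ) :
    IntervalIntegrable g volume a b :=
  ((Lp_locallyIntegrable g).integrableOn_isCompact isCompact_uIcc).intervalIntegrable

theorem norm_fourierDeriv_sq_le (ξ : ℝ) :
    ‖(2 * Real.pi * Complex.I * ξ : ℂ)‖ ^ 2 ≤ 1 + (2 * Real.pi * ξ) ^ 2 := by
  have : ‖(2 * Real.pi * Complex.I * ξ : ℂ)‖ = |2 * Real.pi * ξ| := by
    simp [abs_mul]
  rw [this, sq_abs]; linarith

/-- A function in `H^s`, `s ≥ 1`, agrees almost everywhere with a primitive of its weak derivative `g ∈ L²`,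
whose Fourier transform is `2πiξ f̂`. -/
theorem MemHs.exists_primitive {s : ℝ} (hs : 1 ≤ s) {f : ℝ → ℝ} (h : MemHs s f) :
    ∃ (g : Lp ℂ 2 (volume : Measure ℝ)) (c : ℂ),
      ((𝓕 g : Lp ℂ 2 (volume : Measure ℝ)) =ᵐ[volume] fun ξ => (2 * Real.pi * Complex.I * ξ) *
        (𝓕 (h.memLp.toLp (fun x => (f x : ℂ))) : Lp ℂ 2 (volume : Measure ℝ)) ξ) ∧
      ∀ᵐ x, (f x : ℂ) = c + ∫ t in 0..x, g t := by
  have hD := h.memLp_mul hs (m := fun ξ => 2 * Real.pi * Complex.I * ξ) (by fun_prop)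
    norm_fourierDeriv_sq_le
  have hB := h.memLp_mul hs (m := fun ξ => (((1 + ‖ξ‖ ^ 2) ^ (1 / 2 : ℝ) : ℝ) : ℂ))
    (Complex.continuous_ofReal.comp (Continuous.rpow_const (by fun_prop) (by norm_num))) (fun ξ => by
      rw [Complex.norm_real, Real.norm_of_nonneg (by positivity), ← Real.rpow_mul_natCast (by positivity)]
      norm_num
      rw [mul_pow]
      nlinarith [Real.pi_gt_three, sq_nonneg ξ, mul_nonneg (sq_nonneg ξ) (by nlinarith [Real.pi_gt_three] : 0 ≤ (2 * Real.pi) ^ 2 - 1)])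
  obtain ⟨S, hS, hSf⟩ := exists_weakDeriv (h.memLp.toLp _) (𝓕⁻ (hD.toLp _)) hB
    (by rw [FourierTransform.fourier_fourierInv_eq]; exact hD.coeFn_toLp)
  have hint : ∀ a b, IntervalIntegrable (𝓕⁻ (hD.toLp _) : Lp ℂ 2 (volume : Measure ℝ)) volume a b :=
    fun a b => Lp_intervalIntegrable _ a b
  obtain ⟨a, ha⟩ := hS.exists
  refine ⟨𝓕⁻ (hD.toLp _), h.memLp.toLp _ a - ∫ t in 0..a, (𝓕⁻ (hD.toLp _) : Lp ℂ 2 (volume : Measure ℝ)) t,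
    by rw [FourierTransform.fourier_fourierInv_eq]; exact hD.coeFn_toLp, ?_⟩
  filter_upwards [hS, h.memLp.coeFn_toLp] with x hx hxf
  rw [← hxf]
  have h1 := hSf a ha x hx
  rw [← intervalIntegral.integral_interval_sub_left (hint 0 x) (hint 0 a)] at h1
  linear_combination h1

theorem MemHs.exists_continuous_ae_eq {s : ℝ} (hs : 1 ≤ s) {f : ℝ → ℝ} (h : MemHs s f) :
    ∃ g : ℝ → ℝ, Continuous g ∧ f =ᵐ[volume] g := by
  obtain ⟨g, c, -, hc⟩ := h.exists_primitive hs
  refine ⟨fun x => (c + ∫ t in 0..x, g t).re, ?_, ?_⟩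
  · refine Complex.continuous_re.comp (continuous_const.add ?_)
    exact intervalIntegral.continuous_primitive (fun a b => Lp_intervalIntegrable _ a b) 0
  · filter_upwards [hc] with x hx
    rw [← hx]; simp

/-- The continuous representative of a function in `H^s`, `s ≥ 1`, is locally absolutely continuous, and its
pointwise derivative is the weak derivative, with the expected bound in `H^(s-1)`. -/
theorem MemHs.absolutelyContinuous_and_deriv_le {s : ℝ} (hs : 1 ≤ s) {f : ℝ → ℝ} (hf : Continuous f) (h : MemHs s f) :
    (∀ a b, AbsolutelyContinuousOnInterval f a b) ∧
      sobolevNorm (s - 1) (deriv f) ≤ sobolevNorm s f := by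
  obtain ⟨g, c, hg, hc⟩ := h.exists_primitive hs
  have hint : ∀ a b, IntervalIntegrable g volume a b := fun a b =>
    Lp_intervalIntegrable _ a b
  have hall : ∀ x, (f x : ℂ) = c + ∫ t in 0..x, g t := by
    have := (Continuous.ae_eq_iff_eq (μ := volume) (Complex.continuous_ofReal.comp hf)
      (continuous_const.add (intervalIntegral.continuous_primitive hint 0))).1 hc
    exact congrFun this
  have hre : ∀ a b, IntervalIntegrable (fun x => (g x).re) volume a b := fun a b =>
    ⟨(hint a b).1.re, (hint a b).2.re⟩
  have hderiv : ∀ᵐ x, HasDerivAt f (g x).re x ∧ (g x).im = 0 := by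
    filter_upwards [LocallyIntegrable.ae_hasDerivAt_integral (Lp_locallyIntegrable g)] with x hx
    have h1 : HasDerivAt (fun x => (f x : ℂ)) (g x) x := by
      have := (hx 0).const_add c
      exact this.congr_of_eventuallyEq (Eventually.of_forall hall)
    have h2 := Complex.reCLM.hasFDerivAt.comp_hasDerivAt x h1
    have h3 := Complex.imCLM.hasFDerivAt.comp_hasDerivAt x h1
    simp [Function.comp_def] at h2 h3
    exact ⟨h2, h3.unique (hasDerivAt_const x (0 : ℝ))⟩
  have hde : (fun x => ((deriv f x : ℝ) : ℂ)) =ᵐ[volume] g := by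
    filter_upwards [hderiv] with x hx
    rw [hx.1.deriv]
    exact Complex.ext (by simp) (by simp [hx.2])
  have hgL : MemLp (fun x => ((deriv f x : ℝ) : ℂ)) 2 volume := (memLp_congr_ae hde).2 (Lp.memLp g)
  have hgeq : hgL.toLp _ = g := by
    rw [← Lp.toLp_coeFn g (Lp.memLp g)]
    exact (MemLp.toLp_eq_toLp_iff _ _).2 hde
  constructor
  · intro a b
    have hfa : ∀ x, f x = f a + ∫ t in a..x, (g t).re := by
      intro x
      have h1 : ((f x : ℝ) : ℂ) - f a = ∫ t in a..x, g t := by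
        rw [hall, hall, ← intervalIntegral.integral_interval_sub_left (hint 0 x) (hint 0 a)]; ring
      have h2 := congrArg Complex.reCLM h1
      rw [← ContinuousLinearMap.intervalIntegral_comp_comm _ (hint a x)] at h2
      simp at h2
      linarith
    have h1 := (hre a b).absolutelyContinuousOnInterval_intervalIntegral (c := a) (by simp)
    have h2 : AbsolutelyContinuousOnInterval (fun _ : ℝ => f a) a b :=
      (LipschitzWith.const (f a)).lipschitzOnWith.absolutelyContinuousOnInterval
    have h3 := h2.add h1
    rwa [show f = (fun _ => f a) + fun x => ∫ t in a..x, (g t).re from funext hfa]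
  · rw [sobolevNorm_eq _ hgL, sobolevNorm_eq _ h.memLp, hgeq]
    refine ENNReal.rpow_le_rpow (lintegral_mono_ae ?_) (by norm_num)
    filter_upwards [hg] with ξ hξ
    rw [hξ]
    exact ofReal_mul_enorm_sq_le (norm_fourierDeriv_sq_le ξ) (by linarith) _

theorem MemHs.absolutelyContinuous {s : ℝ} (hs : 1 ≤ s) {f : ℝ → ℝ} (hf : Continuous f)
    (h : MemHs s f) (a b : ℝ) : AbsolutelyContinuousOnInterval f a b :=
  (h.absolutelyContinuous_and_deriv_le hs hf).1 a b

/-- Differentiation is bounded from `H^s` to `H^(s-1)`; if `f ∉ H^s`, the right-hand side is `∞`. -/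
theorem sobolevNorm_deriv_le {s : ℝ} (hs : 1 ≤ s) {f : ℝ → ℝ} (hf : Continuous f) :
    sobolevNorm (s - 1) (deriv f) ≤ sobolevNorm s f := by
  by_cases h : MemHs s f
  · exact (h.absolutelyContinuous_and_deriv_le hs hf).2
  · rw [MemHs, not_lt, top_le_iff] at h
    rw [h]; exact le_top

theorem MemHs.deriv {s : ℝ} (hs : 1 ≤ s) {f : ℝ → ℝ} (hf : Continuous f) (h : MemHs s f) :
    MemHs (s - 1) (deriv f) :=
  lt_of_le_of_lt (sobolevNorm_deriv_le hs hf) h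

theorem MemHs.contDiff_one {s : ℝ} (hs : 2 ≤ s) {f : ℝ → ℝ} (hf : Continuous f) (h : MemHs s f) :
    ContDiff ℝ 1 f := by
  obtain ⟨g, hg, hgf⟩ := (h.deriv (by linarith) hf).exists_continuous_ae_eq (by linarith)
  have h1 : ∀ x, f x = f 0 + ∫ t in 0..x, g t := fun x => by
    have h2 := (h.absolutelyContinuous (by linarith) hf 0 x).integral_deriv_eq_sub
    rw [← intervalIntegral.integral_congr_ae (hgf.mono fun _ h _ => h), h2]; ring
  have h3 : ∀ x, HasDerivAt f (g x) x := fun x => by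
    have := (intervalIntegral.integral_hasDerivAt_right (hg.intervalIntegrable 0 x)
      (hg.stronglyMeasurableAtFilter _ _) hg.continuousAt).const_add (f 0)
    exact this.congr_of_eventuallyEq (Eventually.of_forall h1)
  rw [contDiff_one_iff_deriv]
  refine ⟨fun x => (h3 x).differentiableAt, ?_⟩
  rwa [show _root_.deriv f = g from funext fun x => (h3 x).deriv]

/-! ### Absolutely continuous functions and `H¹` -/

/-- `f ∈ H¹(ℝ)`, in terms of the absolutely continuous representative. -/
structure IsH1 (f : ℝ → ℝ) : Prop where
  ac : ∀ a b, AbsolutelyContinuousOnInterval f a b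
  memLp : MemLp f 2 volume
  memLp_deriv : MemLp (deriv f) 2 volume

theorem continuous_of_ac {f : ℝ → ℝ} (h : ∀ a b, AbsolutelyContinuousOnInterval f a b) :
    Continuous f := by
  rw [continuous_iff_continuousAt]
  intro x
  refine (h (x - 1) (x + 1)).continuousOn.continuousAt ?_
  rw [Set.uIcc_of_le (by linarith)]
  exact Icc_mem_nhds (by linarith) (by linarith)

theorem ae_differentiableAt_of_ac {f : ℝ → ℝ} (h : ∀ a b, AbsolutelyContinuousOnInterval f a b) :
    ∀ᵐ x, DifferentiableAt ℝ f x := by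
  have : ∀ᵐ x, ∀ n : ℕ, x ∈ Set.uIcc (-(n : ℝ)) n → DifferentiableAt ℝ f x :=
    ae_all_iff.2 fun n => (h _ _).ae_differentiableAt
  filter_upwards [this] with x hx
  obtain ⟨n, hn⟩ := exists_nat_ge |x|
  refine hx n ?_
  rw [Set.uIcc_of_le (by linarith [abs_nonneg x])]
  exact abs_le.1 hn

theorem ac_of_contDiff {f : ℝ → ℝ} (h : ContDiff ℝ 1 f) (a b : ℝ) :
    AbsolutelyContinuousOnInterval f a b :=
  h.contDiffOn.absolutelyContinuousOnInterval

/-- A Lipschitz function of an absolutely continuous function is absolutely continuous. -/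
theorem ac_comp_of_lipschitzOnWith {f g : ℝ → ℝ} {a b : ℝ} (hf : AbsolutelyContinuousOnInterval f a b)
    {K : NNReal} {s : Set ℝ} (hg : LipschitzOnWith K g s) (hs : ∀ x ∈ Set.uIcc a b, f x ∈ s) :
    AbsolutelyContinuousOnInterval (fun x => g (f x)) a b := by
  rw [absolutelyContinuousOnInterval_iff] at hf ⊢
  intro ε hε
  obtain ⟨δ, hδ, h⟩ := hf (ε / (K + 1)) (by positivity)
  refine ⟨δ, hδ, fun E hE hlen => ?_⟩
  have h1 := h E hE hlen
  have h2 : ∀ i ∈ Finset.range E.1, dist (g (f (E.2 i).1)) (g (f (E.2 i).2)) ≤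
      K * dist (f (E.2 i).1) (f (E.2 i).2) := fun i hi => by
    have := hE.1 i hi
    exact hg.dist_le_mul _ (hs _ this.1) _ (hs _ this.2)
  calc ∑ i ∈ Finset.range E.1, dist (g (f (E.2 i).1)) (g (f (E.2 i).2))
      ≤ K * ∑ i ∈ Finset.range E.1, dist (f (E.2 i).1) (f (E.2 i).2) := by
        rw [Finset.mul_sum]; exact Finset.sum_le_sum h2
    _ ≤ K * (ε / (K + 1)) := by gcongr
    _ < ε := by
        rw [mul_div_assoc', div_lt_iff₀ (by positivity)]
        linarith

theorem ac_comp_of_contDiff {f g : ℝ → ℝ} (hf : ∀ a b, AbsolutelyContinuousOnInterval f a b)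
    (hg : ContDiff ℝ 1 g) (a b : ℝ) : AbsolutelyContinuousOnInterval (fun x => g (f x)) a b := by
  obtain ⟨R, hR⟩ := (hf a b).exists_bound
  obtain ⟨K, hK⟩ := hg.contDiffOn.exists_lipschitzOnWith (s := Set.Icc (-R) R) (by simp)
    (convex_Icc _ _) isCompact_Icc
  exact ac_comp_of_lipschitzOnWith (hf a b) hK fun x hx => abs_le.1 (hR x hx)

theorem contDiff_abs_rpow {q : ℝ} (hq : 1 < q) : ContDiff ℝ 1 (fun x : ℝ => |x| ^ q) := by
  rw [contDiff_one_iff_deriv]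
  refine ⟨fun x => (hasDerivAt_abs_rpow x hq).differentiableAt, ?_⟩
  have := (contDiff_norm_rpow (E := ℝ) hq).continuous_deriv_one
  simpa using this

/-- The integral over the line of the derivative of an integrable function is zero. -/
theorem integral_deriv_eq_zero {H : ℝ → ℝ} (hac : ∀ a b, AbsolutelyContinuousOnInterval H a b)
    (hH : Integrable H) (hH' : Integrable (deriv H)) : ∫ x, deriv H x = 0 := by
  have htop : Tendsto (fun x => ∫ t in 0..x, deriv H t) atTop (𝓝 (∫ t in Set.Ioi 0, deriv H t)) :=
    intervalIntegral_tendsto_integral_Ioi 0 hH'.integrableOn tendsto_id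
  have hbot : Tendsto (fun x => ∫ t in x..0, deriv H t) atBot (𝓝 (∫ t in Set.Iic 0, deriv H t)) :=
    intervalIntegral_tendsto_integral_Iic 0 hH'.integrableOn tendsto_id
  have h1 : H 0 + ∫ t in Set.Ioi 0, deriv H t = 0 := by
    refine IntegrableAtFilter.eq_zero_of_tendsto (l := atTop) (μ := volume) (f := H)
      (hH.integrableAtFilter _) ?_ ?_
    · intro s hs
      obtain ⟨b, hb⟩ := mem_atTop_sets.1 hs
      rw [← top_le_iff, ← Real.volume_Ici (a := b)]
      exact measure_mono hb
    · refine (htop.const_add (H 0)).congr fun x => ?_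
      rw [(hac 0 x).integral_deriv_eq_sub]; ring
  have h2 : H 0 - ∫ t in Set.Iic 0, deriv H t = 0 := by
    refine IntegrableAtFilter.eq_zero_of_tendsto (l := atBot) (μ := volume) (f := H)
      (hH.integrableAtFilter _) ?_ ?_
    · intro s hs
      obtain ⟨b, hb⟩ := mem_atBot_sets.1 hs
      rw [← top_le_iff, ← Real.volume_Iic (a := b)]
      exact measure_mono hb
    · refine (hbot.const_sub (H 0)).congr fun x => ?_
      rw [(hac x 0).integral_deriv_eq_sub]; ring
  have h3 := intervalIntegral.integral_Iic_add_Ioi (b := 0) hH'.integrableOn hH'.integrableOn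
  linarith

/-- One-dimensional Sobolev inequality. -/
theorem enorm_le_of_ac {f : ℝ → ℝ} (hac : ∀ a b, AbsolutelyContinuousOnInterval f a b) (x : ℝ) :
    ‖f x‖ₑ ≤ eLpNorm f 2 volume + eLpNorm (deriv f) 2 volume := by
  set μ : Measure ℝ := volume.restrict (Set.Ioc x (x + 1)) with hμ
  have : IsProbabilityMeasure μ := ⟨by simp [hμ]⟩
  have hloc : ∀ g : ℝ → ℝ, Measurable g → ∫⁻ y, ‖g y‖ₑ ∂μ ≤ eLpNorm g 2 volume := fun g hg => by
    rw [← eLpNorm_one_eq_lintegral_enorm]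
    exact (eLpNorm_le_eLpNorm_of_exponent_le (by norm_num) hg.aestronglyMeasurable).trans
      (eLpNorm_mono_measure _ Measure.restrict_le_self)
  have hpt : ∀ y ∈ Set.Ioc x (x + 1), ‖f x‖ₑ ≤ ‖f y‖ₑ + ∫⁻ t, ‖deriv f t‖ₑ ∂μ := by
    intro y hy
    have h1 : f x = f y - ∫ t in Set.Ioc x y, deriv f t := by
      rw [← intervalIntegral.integral_of_le hy.1.le, (hac x y).integral_deriv_eq_sub]; ring
    calc ‖f x‖ₑ = ‖f y - ∫ t in Set.Ioc x y, deriv f t‖ₑ := by rw [← h1]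
      _ ≤ ‖f y‖ₑ + ‖∫ t in Set.Ioc x y, deriv f t‖ₑ := enorm_sub_le
      _ ≤ ‖f y‖ₑ + ∫⁻ t in Set.Ioc x y, ‖deriv f t‖ₑ := by
          gcongr; exact enorm_integral_le_lintegral_enorm _
      _ ≤ ‖f y‖ₑ + ∫⁻ t, ‖deriv f t‖ₑ ∂μ := by
          gcongr; exact Measure.restrict_mono_set _ (Set.Ioc_subset_Ioc_right hy.2)
  calc ‖f x‖ₑ = ∫⁻ _, ‖f x‖ₑ ∂μ := by simp
    _ ≤ ∫⁻ y, (‖f y‖ₑ + ∫⁻ t, ‖deriv f t‖ₑ ∂μ) ∂μ :=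
        lintegral_mono_ae ((ae_restrict_iff' measurableSet_Ioc).2 (Eventually.of_forall hpt))
    _ = ∫⁻ y, ‖f y‖ₑ ∂μ + ∫⁻ t, ‖deriv f t‖ₑ ∂μ := by
        rw [lintegral_add_right _ measurable_const]; simp
    _ ≤ _ := add_le_add (hloc f (continuous_of_ac hac).measurable) (hloc _ (measurable_deriv f))

/-- `Lᵖ` lies between `L²` and `L^∞`. -/
theorem eLpNorm_le_two_add_top {f : ℝ → ℝ} {p : ℝ≥0∞} (hp : 2 ≤ p) :
    eLpNorm f p volume ≤ eLpNorm f 2 volume + eLpNorm f ∞ volume := by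
  rcases eq_or_ne p ∞ with rfl | hp'
  · exact le_add_self
  set N := eLpNorm f 2 volume + eLpNorm f ∞ volume with hN
  have hp0 : p ≠ 0 := by rintro rfl; simp at hp
  have hq : 2 ≤ p.toReal := by simpa using ENNReal.toReal_mono hp' hp
  have h2 : ∫⁻ x, ‖f x‖ₑ ^ (2 : ℝ) ≤ N ^ (2 : ℝ) := by
    have : (∫⁻ x, ‖f x‖ₑ ^ (2 : ℝ)) = eLpNorm f 2 volume ^ (2 : ℝ) := by
      rw [eLpNorm_eq_lintegral_rpow_enorm_toReal (by norm_num) (by norm_num), ← ENNReal.rpow_mul]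
      simp
    rw [this]; gcongr; exact le_self_add
  have h3 : ∀ᵐ x, ‖f x‖ₑ ≤ N := by
    filter_upwards [ae_le_eLpNormEssSup (f := f) (μ := volume)] with x hx
    rw [← eLpNorm_exponent_top] at hx
    exact hx.trans le_add_self
  rw [eLpNorm_eq_lintegral_rpow_enorm_toReal hp0 hp', one_div,
    ENNReal.rpow_inv_le_iff (by linarith)]
  have hsplit : ∀ z : ℝ≥0∞, z ^ p.toReal = z ^ (p.toReal - 2) * z ^ (2 : ℝ) := fun z => by
    rw [← ENNReal.rpow_add_of_nonneg _ _ (by linarith) (by norm_num)]; ring_nf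
  calc ∫⁻ x, ‖f x‖ₑ ^ p.toReal ≤ ∫⁻ x, N ^ (p.toReal - 2) * ‖f x‖ₑ ^ (2 : ℝ) := by
        refine lintegral_mono_ae ?_
        filter_upwards [h3] with x hx
        rw [hsplit]
        gcongr
    _ ≤ N ^ (p.toReal - 2) * N ^ (2 : ℝ) := by
        rcases eq_or_ne N ∞ with h | h
        · rcases eq_or_lt_of_le hq with h4 | h4
          · simp [← h4, h]
          · rw [h]
            rw [ENNReal.top_rpow_of_pos (by linarith), ENNReal.top_rpow_of_pos (by norm_num)]
            simp
        · rw [lintegral_const_mul' _ _ (ENNReal.rpow_ne_top_of_nonneg (by linarith) h)]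
          gcongr
    _ = N ^ p.toReal := (hsplit N).symm

theorem IsH1.continuous {f : ℝ → ℝ} (h : IsH1 f) : Continuous f := continuous_of_ac h.ac

theorem eLpNorm_le_of_ac {f : ℝ → ℝ} (hac : ∀ a b, AbsolutelyContinuousOnInterval f a b)
    {p : ℝ≥0∞} (hp : 2 ≤ p) :
    eLpNorm f p volume ≤ 2 * (eLpNorm f 2 volume + eLpNorm (deriv f) 2 volume) := by
  have h1 : eLpNorm f ∞ volume ≤ eLpNorm f 2 volume + eLpNorm (deriv f) 2 volume := by
    rw [eLpNorm_exponent_top]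
    exact eLpNormEssSup_le_of_ae_enorm_bound (Eventually.of_forall (enorm_le_of_ac hac))
  calc _ ≤ _ := eLpNorm_le_two_add_top hp
    _ ≤ (eLpNorm f 2 volume + eLpNorm (deriv f) 2 volume) +
        (eLpNorm f 2 volume + eLpNorm (deriv f) 2 volume) := add_le_add le_self_add h1
    _ = _ := (two_mul _).symm

theorem IsH1.memLp_of_two_le {f : ℝ → ℝ} (h : IsH1 f) {p : ℝ≥0∞} (hp : 2 ≤ p) :
    MemLp f p volume :=
  ⟨h.memLp.1, lt_of_le_of_lt (eLpNorm_le_of_ac h.ac hp) (ENNReal.mul_lt_top (by simp)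
    (ENNReal.add_lt_top.2 ⟨h.memLp.2, h.memLp_deriv.2⟩))⟩

theorem IsH1.exists_bound {f : ℝ → ℝ} (h : IsH1 f) : ∃ K : ℝ, 0 ≤ K ∧ ∀ x, |f x| ≤ K := by
  refine ⟨(eLpNorm f 2 volume + eLpNorm (deriv f) 2 volume).toReal, ENNReal.toReal_nonneg,
    fun x => ?_⟩
  have := ENNReal.toReal_mono (ENNReal.add_lt_top.2 ⟨h.memLp.2, h.memLp_deriv.2⟩).ne
    (enorm_le_of_ac h.ac x)
  simpa using this

/-- For a continuous function an essential bound is a bound at every point. -/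
theorem abs_le_of_eLpNorm_top_le {f : ℝ → ℝ} (hf : Continuous f) {M : ℝ} (hM : 0 ≤ M)
    (h : eLpNorm f ∞ volume ≤ ENNReal.ofReal M) (x : ℝ) : |f x| ≤ M := by
  have hae : ∀ᵐ x, |f x| ≤ M := by
    filter_upwards [ae_le_eLpNormEssSup (f := f) (μ := volume)] with x hx
    rw [← eLpNorm_exponent_top] at hx
    have := hx.trans h
    rwa [← ofReal_norm, ENNReal.ofReal_le_ofReal_iff hM, Real.norm_eq_abs] at this
  have hcl : IsClosed {x | |f x| ≤ M} := isClosed_le hf.abs continuous_const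
  have hd : Dense {x | |f x| ≤ M} := Measure.dense_of_ae hae
  have := hcl.closure_eq ▸ hd.closure_eq
  exact (this ▸ Set.mem_univ x : x ∈ {x | |f x| ≤ M})

theorem MemHs.memLp_real {s : ℝ} {f : ℝ → ℝ} (h : MemHs s f) : MemLp f 2 volume := by
  simpa using h.memLp.re

theorem MemHs.isH1 {s : ℝ} (hs : 1 ≤ s) {f : ℝ → ℝ} (hf : Continuous f) (h : MemHs s f) : IsH1 f :=
  ⟨h.absolutelyContinuous hs hf, h.memLp_real, (h.deriv hs hf).memLp_real⟩

/-- Sobolev embedding of `H^s` in `Lᵖ`. -/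
theorem eLpNorm_le_mul_sobolevNorm {s : ℝ} (hs : 1 ≤ s) {f : ℝ → ℝ} (hf : Continuous f)
    {p : ℝ≥0∞} (hp : 2 ≤ p) : eLpNorm f p volume ≤ 4 * sobolevNorm s f := by
  by_cases h : MemHs s f
  · calc _ ≤ _ := eLpNorm_le_of_ac (h.absolutelyContinuous hs hf) hp
      _ ≤ 2 * (sobolevNorm s f + sobolevNorm s f) := by
        gcongr
        · exact eLpNorm_le_sobolevNorm (by linarith) f
        · exact (eLpNorm_le_sobolevNorm (by linarith) _).trans (sobolevNorm_deriv_le hs hf)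
      _ = _ := by ring
  · rw [MemHs, not_lt, top_le_iff] at h
    rw [h]; simp

/-! ### Weights and their truncations -/

/-- A bounded positive locally absolutely continuous weight `φ` with `|φ'| ≤ A φ`. Boundedness makes
`φ f ∈ Lᵖ` for every `f ∈ Lᵖ`, so that all weighted norms of a solution are finite. -/
structure IsBoundedWeight (A : ℝ) (φ : ℝ → ℝ) : Prop where
  pos : ∀ x, 0 < φ x
  bdd : ∃ N, ∀ x, φ x ≤ N
  ac : ∀ a b, AbsolutelyContinuousOnInterval φ a b
  deriv_le : ∀ᵐ x, |deriv φ x| ≤ A * φ x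

theorem antitone_of_ac {f : ℝ → ℝ} (h : ∀ a b, AbsolutelyContinuousOnInterval f a b)
    (hd : ∀ᵐ x, deriv f x ≤ 0) : Antitone f := by
  intro a b hab
  have h1 := (h a b).integral_deriv_eq_sub
  have h2 : ∫ x in a..b, deriv f x ≤ 0 := by
    rw [intervalIntegral.integral_of_le hab]
    exact integral_nonpos_of_ae (ae_restrict_of_ae hd)
  linarith

theorem ac_exp_mul {φ : ℝ → ℝ} (h : ∀ a b, AbsolutelyContinuousOnInterval φ a b) (A a b : ℝ) :
    AbsolutelyContinuousOnInterval (fun x => Real.exp (A * x) * φ x) a b :=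
  (ac_of_contDiff (f := fun x => Real.exp (A * x)) (by fun_prop) a b).fun_mul (h a b)

/-- The bound `|φ'| ≤ A φ` in integrated form, which is stable under truncation. -/
theorem antitone_exp_mul {A : ℝ} {φ : ℝ → ℝ} (h : ∀ a b, AbsolutelyContinuousOnInterval φ a b)
    (hd : ∀ᵐ x, |deriv φ x| ≤ A * φ x) :
    Antitone (fun x => Real.exp (-A * x) * φ x) ∧ Monotone (fun x => Real.exp (A * x) * φ x) := by
  have hder : ∀ (B x : ℝ), DifferentiableAt ℝ φ x →
      HasDerivAt (fun x => Real.exp (B * x) * φ x) (Real.exp (B * x) * (B * φ x + deriv φ x)) x := by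
    intro B x hx
    have h1 : HasDerivAt (fun x => Real.exp (B * x)) (Real.exp (B * x) * B) x := by
      simpa using ((hasDerivAt_id x).const_mul B).exp
    exact (h1.fun_mul hx.hasDerivAt).congr_deriv (by ring)
  constructor
  · refine antitone_of_ac (ac_exp_mul h _) ?_
    filter_upwards [ae_differentiableAt_of_ac h, hd] with x hx hx2
    rw [(hder (-A) x hx).deriv]
    exact mul_nonpos_of_nonneg_of_nonpos (Real.exp_pos _).le (by linarith [(abs_le.1 hx2).2])
  · have : Antitone (fun x => -(Real.exp (A * x) * φ x)) := by
      refine antitone_of_ac (fun a b => (ac_exp_mul h A a b).neg) ?_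
      filter_upwards [ae_differentiableAt_of_ac h, hd] with x hx hx2
      rw [(hder A x hx).fun_neg.deriv]
      exact neg_nonpos_of_nonneg (mul_nonneg (Real.exp_pos _).le (by linarith [(abs_le.1 hx2).1]))
    intro a b hab
    have := this hab
    simp at this
    exact this

/-- The truncation of a weight is a weight with the same constant: `e^(-Ax) min(φ, N)` is non-increasing and
`e^(Ax) min(φ, N)` is non-decreasing. -/
theorem isBoundedWeight_min {A : ℝ} (hA : 0 < A) {φ : ℝ → ℝ} (hpos : ∀ x, 0 < φ x)
    (h : ∀ a b, AbsolutelyContinuousOnInterval φ a b)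
    (hd : ∀ᵐ x, |deriv φ x| ≤ A * φ x) {N : ℝ} (hN : 0 < N) :
    IsBoundedWeight A (fun x => min (φ x) N) := by
  have hac : ∀ a b, AbsolutelyContinuousOnInterval (fun x => min (φ x) N) a b := fun a b =>
    ac_comp_of_lipschitzOnWith (h a b) (g := fun y => min y N)
      ((LipschitzWith.id.min_const N).lipschitzOnWith (s := Set.univ)) (by simp)
  obtain ⟨h1, h2⟩ := antitone_exp_mul h hd
  have hanti : Antitone (fun x => Real.exp (-A * x) * min (φ x) N) := by
    intro x y hxy
    simp only [mul_min_of_nonneg _ _ (Real.exp_pos _).le]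
    refine min_le_min (h1 hxy) (mul_le_mul_of_nonneg_right (Real.exp_le_exp.2 ?_) hN.le)
    nlinarith
  have hmono : Monotone (fun x => Real.exp (A * x) * min (φ x) N) := by
    intro x y hxy
    simp only [mul_min_of_nonneg _ _ (Real.exp_pos _).le]
    refine min_le_min (h2 hxy) (mul_le_mul_of_nonneg_right (Real.exp_le_exp.2 ?_) hN.le)
    nlinarith
  refine ⟨fun x => lt_min (hpos x) hN, ⟨N, fun x => min_le_right _ _⟩, hac, ?_⟩
  filter_upwards [ae_differentiableAt_of_ac hac] with x hx
  have hder : ∀ B : ℝ, HasDerivAt (fun x => Real.exp (B * x) * min (φ x) N)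
      (Real.exp (B * x) * (B * min (φ x) N + deriv (fun x => min (φ x) N) x)) x := by
    intro B
    have h1 : HasDerivAt (fun x => Real.exp (B * x)) (Real.exp (B * x) * B) x := by
      simpa using ((hasDerivAt_id x).const_mul B).exp
    exact (h1.fun_mul hx.hasDerivAt).congr_deriv (by ring)
  have h3 : deriv (fun x => Real.exp (-A * x) * min (φ x) N) x ≤ 0 := hanti.deriv_nonpos
  have h4 : 0 ≤ deriv (fun x => Real.exp (A * x) * min (φ x) N) x := hmono.deriv_nonneg
  rw [(hder _).deriv] at h3 h4
  have h5 := nonpos_of_mul_nonpos_right h3 (Real.exp_pos _)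
  have h6 := nonneg_of_mul_nonneg_right h4 (Real.exp_pos _)
  exact abs_le.2 ⟨by linarith, by linarith⟩

section Duality

variable {A q : ℝ} {φ : ℝ → ℝ}

theorem IsBoundedWeight.memLp_mul (hφ : IsBoundedWeight A φ) {f : ℝ → ℝ} {p : ℝ≥0∞}
    (hf : MemLp f p volume) : MemLp (fun x => φ x * f x) p volume := by
  obtain ⟨N, hN⟩ := hφ.bdd
  refine hf.of_le_mul (c := N) ((continuous_of_ac hφ.ac).aestronglyMeasurable.mul hf.1)
    (Eventually.of_forall fun x => ?_)
  rw [norm_mul, Real.norm_of_nonneg (hφ.pos x).le]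
  gcongr
  exact hN x

/-- `∫ |F|^(q-2) F G ≤ ‖F‖_q^(q-1) ‖G‖_q`. -/
theorem integral_dual_le (hq : 2 ≤ q) {F G : ℝ → ℝ} (hF : MemLp F (ENNReal.ofReal q) volume)
    (hG : MemLp G (ENNReal.ofReal q) volume) :
    ∫ x, |F x| ^ (q - 2) * F x * G x ≤
      (eLpNorm F (ENNReal.ofReal q) volume).toReal ^ (q - 1) *
        (eLpNorm G (ENNReal.ofReal q) volume).toReal := by
  have hq0 : 0 < q := by linarith
  have hconj : (q / (q - 1)).HolderConjugate q := by
    rw [Real.holderConjugate_comm, Real.holderConjugate_iff]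
    exact ⟨by linarith, by field_simp; ring⟩
  have hnorm : ∀ {F : ℝ → ℝ}, MemLp F (ENNReal.ofReal q) volume →
      (eLpNorm F (ENNReal.ofReal q) volume).toReal = (∫ x, |F x| ^ q) ^ (1 / q) := by
    intro F hF
    rw [hF.eLpNorm_eq_integral_rpow_norm (by simpa using hq0) (by simp),
      ENNReal.toReal_ofReal (by positivity), ENNReal.toReal_ofReal hq0.le]
    simp
  have hpow : ∀ x, |(|F x| ^ (q - 2) * F x)| = |F x| ^ (q - 1) := fun x => by
    rw [abs_mul, abs_of_nonneg (by positivity : 0 ≤ |F x| ^ (q - 2))]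
    rcases eq_or_ne (F x) 0 with h | h
    · simp [h, Real.zero_rpow (by linarith : q - 1 ≠ 0)]
    · rw [← Real.rpow_add_one (abs_ne_zero.2 h)]; ring_nf
  have hF1 : MemLp (fun x => |F x| ^ (q - 1)) (ENNReal.ofReal (q / (q - 1))) volume := by
    have := hF.norm_rpow_div (ENNReal.ofReal (q - 1))
    rw [ENNReal.toReal_ofReal (by linarith), ← ENNReal.ofReal_div_of_pos (by linarith)] at this
    exact this
  calc ∫ x, |F x| ^ (q - 2) * F x * G x ≤ ∫ x, |F x| ^ (q - 1) * |G x| := by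
        refine (le_abs_self _).trans ((abs_integral_le_integral_abs).trans_eq ?_)
        congr 1; ext x
        rw [abs_mul, hpow]
    _ ≤ (∫ x, (|F x| ^ (q - 1)) ^ (q / (q - 1))) ^ (1 / (q / (q - 1))) *
          (∫ x, |G x| ^ q) ^ (1 / q) :=
        integral_mul_le_Lp_mul_Lq_of_nonneg hconj (Eventually.of_forall fun x => by positivity)
          (Eventually.of_forall fun x => by positivity) hF1 hG.abs
    _ = _ := by
        rw [hnorm hF, hnorm hG]
        congr 1
        rw [← Real.rpow_mul (integral_nonneg fun x => by positivity)]
        congr 1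
        · congr 1; ext x
          rw [← Real.rpow_mul (abs_nonneg _), mul_div_cancel₀ _ (by linarith)]
        · field_simp

theorem integral_abs_rpow_eq (hq : 2 ≤ q) {F : ℝ → ℝ} (hF : MemLp F (ENNReal.ofReal q) volume) :
    ∫ x, |F x| ^ (q - 2) * F x * F x = (eLpNorm F (ENNReal.ofReal q) volume).toReal ^ q := by
  have hq0 : 0 < q := by linarith
  rw [hF.eLpNorm_eq_integral_rpow_norm (by simpa using hq0) (by simp),
    ENNReal.toReal_ofReal (by positivity), ENNReal.toReal_ofReal hq0.le,
    Real.rpow_inv_rpow (integral_nonneg fun x => by positivity) hq0.ne']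
  congr 1; ext x
  rw [mul_assoc, ← sq, Real.norm_eq_abs, ← sq_abs, ← Real.rpow_add_natCast']
  · norm_num
  · positivity
  · norm_num; linarith

/-! ### The weighted energy estimate -/

/-- The function `J = |φf|^(q-2) (φf) φ`. The functional `g ↦ ‖φf‖_q^(1-q) ∫ J g` is the derivative of
`g ↦ ‖φg‖_q` at `f ≠ 0`. -/
noncomputable def dualWeight (q : ℝ) (φ f : ℝ → ℝ) (x : ℝ) : ℝ := |φ x * f x| ^ (q - 2) * (φ x * f x) * φ x

/-- As `q ≥ 2` and `φ`, `f` are bounded, `J` is bounded by a multiple of `|f|`, so that it can be paired with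
functions in `L²`; hence difference quotients that converge in `L²` suffice. -/
theorem memLp_dualWeight (hq : 2 ≤ q) (hφ : IsBoundedWeight A φ) {f : ℝ → ℝ} (hf : IsH1 f) :
    MemLp (dualWeight q φ f) 2 volume := by
  obtain ⟨N, hN⟩ := hφ.bdd
  obtain ⟨K, hK0, hK⟩ := hf.exists_bound
  have hφc := continuous_of_ac hφ.ac
  have hfc := hf.continuous
  have hN0 : 0 ≤ N := (hφ.pos 0).le.trans (hN 0)
  have habs : ∀ x, |φ x| ≤ N := fun x => by rw [abs_of_pos (hφ.pos x)]; exact hN x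
  refine hf.memLp.of_le_mul (c := (N * K) ^ (q - 2) * N * N) ?_ (Eventually.of_forall fun x => ?_)
  · refine Continuous.aestronglyMeasurable ?_
    unfold dualWeight
    exact (((hφc.mul hfc).abs.rpow_const fun x => Or.inr (by linarith)).mul (hφc.mul hfc)).mul hφc
  · rw [dualWeight, Real.norm_eq_abs, abs_mul, abs_mul, abs_of_nonneg (Real.rpow_nonneg (abs_nonneg _) _),
      abs_mul, Real.norm_eq_abs]
    have h1 : (|φ x| * |f x|) ^ (q - 2) ≤ (N * K) ^ (q - 2) :=
      Real.rpow_le_rpow (by positivity) (mul_le_mul (habs x) (hK x) (abs_nonneg _) hN0) (by linarith)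
    calc (|φ x| * |f x|) ^ (q - 2) * (|φ x| * |f x|) * |φ x|
        ≤ (N * K) ^ (q - 2) * (N * |f x|) * N := by
          have := habs x
          gcongr
      _ = _ := by ring

theorem ofReal_two_le (hq : 2 ≤ q) : (2 : ℝ≥0∞) ≤ ENNReal.ofReal q := by
  simpa using ENNReal.ofReal_le_ofReal hq

theorem abs_rpow_eq (hq : 2 ≤ q) (x : ℝ) : |x| ^ q = |x| ^ (q - 2) * x ^ 2 := by
  rw [← sq_abs x, ← Real.rpow_add_natCast']
  · norm_num
  · positivity
  · norm_num; linarith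

theorem abs_mul_rpow (q a b : ℝ) : |a * b| ^ q = |a| ^ q * |b| ^ q := by
  rw [abs_mul, Real.mul_rpow (abs_nonneg _) (abs_nonneg _)]

theorem abs_deriv_abs_rpow_le (hq : 2 ≤ q) (hφ : IsBoundedWeight A φ) :
    ∀ᵐ x, |deriv (fun x => |φ x| ^ q) x| ≤ q * A * |φ x| ^ q := by
  filter_upwards [ae_differentiableAt_of_ac hφ.ac, hφ.deriv_le] with x h1 h2
  have h4 : deriv (fun x => |φ x| ^ q) x = q * |φ x| ^ (q - 2) * φ x * deriv φ x :=
    ((hasDerivAt_abs_rpow (φ x) (by linarith)).comp x h1.hasDerivAt).deriv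
  rw [h4, abs_mul, abs_mul, abs_mul, abs_of_pos (by linarith : 0 < q),
    abs_of_nonneg (Real.rpow_nonneg (abs_nonneg _) _), abs_rpow_eq hq, ← sq_abs (φ x)]
  calc q * |φ x| ^ (q - 2) * |φ x| * |deriv φ x|
      ≤ q * |φ x| ^ (q - 2) * |φ x| * (A * |φ x|) := by
        gcongr
        rwa [abs_of_pos (hφ.pos x)]
    _ = _ := by ring

theorem deriv_weighted_rpow (hq : 2 ≤ q) {f u : ℝ → ℝ} {x : ℝ}
    (h1 : DifferentiableAt ℝ (fun x => |φ x| ^ q) x) (h2 : DifferentiableAt ℝ u x)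
    (h3 : DifferentiableAt ℝ f x) :
    deriv (fun x => |φ x| ^ q * u x * |f x| ^ q) x =
      (deriv (fun x => |φ x| ^ q) x * u x + |φ x| ^ q * deriv u x) * |f x| ^ q +
        q * (dualWeight q φ f x * (u x * deriv f x)) := by
  have h4 : HasDerivAt (fun x => |f x| ^ q) (q * |f x| ^ (q - 2) * f x * deriv f x) x :=
    (hasDerivAt_abs_rpow (f x) (by linarith)).comp x h3.hasDerivAt
  rw [((h1.hasDerivAt.fun_mul h2.hasDerivAt).fun_mul h4).deriv, dualWeight, abs_mul_rpow]
  linear_combination (u x * (q * |f x| ^ (q - 2) * f x * deriv f x)) * abs_rpow_eq hq (φ x)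

/-- The transport term: since `q J f_x u = φ^q u (|f|^q)_x`, integration by parts moves the derivative from `f`
to `φ^q u`, which costs `(qA + 1) M φ^q`. -/
theorem integral_dualWeight_transport_le (hq : 2 ≤ q) (hφ : IsBoundedWeight A φ) {f u : ℝ → ℝ}
    (hf : IsH1 f) (hu : ∀ a b, AbsolutelyContinuousOnInterval u a b) {M : ℝ}
    (huM : ∀ x, |u x| ≤ M) (huM' : ∀ᵐ x, |deriv u x| ≤ M) :
    ∫ x, dualWeight q φ f x * -(u x * deriv f x) ≤
      (A + 1 / q) * M * (eLpNorm (fun x => φ x * f x) (ENNReal.ofReal q) volume).toReal ^ q := by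
  have hq0 : 0 < q := by linarith
  have hq1 : 1 < q := by linarith
  have hM : 0 ≤ M := (abs_nonneg _).trans (huM 0)
  have hφc := continuous_of_ac hφ.ac
  have hfc := hf.continuous
  have huc := continuous_of_ac hu
  have hφf := hφ.memLp_mul (hf.memLp_of_two_le (ofReal_two_le hq))
  obtain ⟨ψ, hψ⟩ : ∃ ψ : ℝ → ℝ, ψ = fun x => |φ x| ^ q := ⟨_, rfl⟩
  obtain ⟨k, hk⟩ : ∃ k : ℝ → ℝ, k = fun x => |f x| ^ q := ⟨_, rfl⟩
  have hψ0 : ∀ x, 0 ≤ ψ x := fun x => by rw [hψ]; positivity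
  have hk0 : ∀ x, 0 ≤ k x := fun x => by rw [hk]; positivity
  have hψac : ∀ a b, AbsolutelyContinuousOnInterval ψ a b :=
    hψ ▸ fun a b => ac_comp_of_contDiff (g := fun x => |x| ^ q) hφ.ac (contDiff_abs_rpow hq1) a b
  have hkac : ∀ a b, AbsolutelyContinuousOnInterval k a b :=
    hk ▸ fun a b => ac_comp_of_contDiff (g := fun x => |x| ^ q) hf.ac (contDiff_abs_rpow hq1) a b
  have hψc : Continuous ψ := continuous_of_ac hψac
  have hkc : Continuous k := continuous_of_ac hkac
  have hHac : ∀ a b, AbsolutelyContinuousOnInterval (fun x => ψ x * u x * k x) a b := fun a b =>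
    ((hψac a b).fun_mul (hu a b)).fun_mul (hkac a b)
  have hI : Integrable (fun x => ψ x * k x) := by
    have := hφf.integrable_norm_rpow (by simpa using hq0) (by simp)
    rw [ENNReal.toReal_ofReal hq0.le] at this
    have heq : (fun x => ψ x * k x) = fun x => ‖φ x * f x‖ ^ q := funext fun x => by
      rw [Real.norm_eq_abs, abs_mul_rpow, hψ, hk]
    rwa [heq]
  have hIN : ∫ x, ψ x * k x = (eLpNorm (fun x => φ x * f x) (ENNReal.ofReal q) volume).toReal ^ q := by
    rw [← integral_abs_rpow_eq hq hφf]
    congr 1; ext x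
    simp only [hψ, hk]
    rw [← abs_mul_rpow, abs_rpow_eq hq]; ring
  have huf : MemLp (fun x => u x * deriv f x) 2 volume :=
    hf.memLp_deriv.of_le_mul (c := M) (huc.aestronglyMeasurable.mul hf.memLp_deriv.1)
      (Eventually.of_forall fun x => by
        rw [norm_mul]; gcongr; exact huM x)
  have hL : Integrable (fun x => dualWeight q φ f x * (u x * deriv f x)) :=
    (memLp_dualWeight hq hφ hf).integrable_mul huf
  obtain ⟨R, hR⟩ : ∃ R : ℝ → ℝ, R = fun x => (deriv ψ x * u x + ψ x * deriv u x) * k x := ⟨_, rfl⟩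
  have hRle : ∀ᵐ x, |R x| ≤ (q * A + 1) * M * (ψ x * k x) := by
    have hψ' := abs_deriv_abs_rpow_le hq hφ
    rw [← hψ] at hψ'
    filter_upwards [hψ', huM'] with x h5' h3
    have h5 : |deriv ψ x| ≤ q * A * ψ x := by rw [hψ] at h5' ⊢; exact h5'
    have hψx := hψ0 x
    have hkx := hk0 x
    rw [hR]; simp only
    rw [abs_mul, abs_of_nonneg hkx]
    calc |deriv ψ x * u x + ψ x * deriv u x| * k x
        ≤ (|deriv ψ x| * |u x| + ψ x * |deriv u x|) * k x := by
          gcongr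
          refine (abs_add_le _ _).trans ?_
          rw [abs_mul, abs_mul, abs_of_nonneg hψx]
      _ ≤ (q * A * ψ x * M + ψ x * M) * k x := by
          have := huM x
          have h6 := (abs_nonneg _).trans h5
          gcongr
      _ = _ := by ring
  have hRint : Integrable R := by
    have hm : Measurable R := hR ▸ (((measurable_deriv ψ).mul huc.measurable).add
      (hψc.measurable.mul (measurable_deriv u))).mul hkc.measurable
    have hle : ∀ᵐ x, ‖R x‖ ≤ (q * A + 1) * M * (ψ x * k x) := by
      simpa only [Real.norm_eq_abs] using hRle
    exact Integrable.mono' (hI.const_mul ((q * A + 1) * M)) hm.aestronglyMeasurable hle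
  have hderiv : ∀ᵐ x, deriv (fun x => ψ x * u x * k x) x =
      R x + q * (dualWeight q φ f x * (u x * deriv f x)) := by
    filter_upwards [ae_differentiableAt_of_ac hψac, ae_differentiableAt_of_ac hu,
      ae_differentiableAt_of_ac hf.ac] with x h1 h2 h3
    rw [hψ] at h1
    rw [hR, hψ, hk]
    exact deriv_weighted_rpow hq h1 h2 h3
  have hH : Integrable (fun x => ψ x * u x * k x) := by
    have hle : ∀ x, ‖ψ x * u x * k x‖ ≤ M * (ψ x * k x) := fun x => by
      have hψx := hψ0 x
      have hkx := hk0 x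
      rw [norm_mul, norm_mul, Real.norm_of_nonneg hψx, Real.norm_of_nonneg hkx]
      calc ψ x * ‖u x‖ * k x ≤ ψ x * M * k x := by gcongr; exact huM x
        _ = _ := by ring
    exact Integrable.mono' (hI.const_mul M) ((hψc.mul huc).mul hkc).aestronglyMeasurable
      (Eventually.of_forall hle)
  have hsum : (∫ x, R x) + q * ∫ x, dualWeight q φ f x * (u x * deriv f x) = 0 := by
    rw [← integral_const_mul, ← integral_add hRint (hL.const_mul q), ← integral_congr_ae hderiv]
    exact integral_deriv_eq_zero hHac hH ((hRint.add (hL.const_mul q)).congr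
      (hderiv.mono fun x h => h.symm))
  have hRI : ∫ x, R x ≤ (q * A + 1) * M * ∫ x, ψ x * k x := by
    rw [← integral_const_mul]
    exact integral_mono_ae hRint (hI.const_mul _) (hRle.mono fun x h => (le_abs_self _).trans h)
  simp only [mul_neg]
  rw [integral_neg, ← hIN]
  have : (A + 1 / q) * M * ∫ x, ψ x * k x = ((q * A + 1) * M * ∫ x, ψ x * k x) / q := by
    field_simp
  rw [this, le_div_iff₀ hq0]
  linarith

theorem integral_dualWeight_le (hq : 2 ≤ q) (hφ : IsBoundedWeight A φ) {f g : ℝ → ℝ}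
    (hf : IsH1 f) (hg : MemLp (fun x => φ x * g x) (ENNReal.ofReal q) volume) :
    ∫ x, dualWeight q φ f x * g x ≤
      (eLpNorm (fun x => φ x * f x) (ENNReal.ofReal q) volume).toReal ^ (q - 1) *
        (eLpNorm (fun x => φ x * g x) (ENNReal.ofReal q) volume).toReal := by
  refine le_of_eq_of_le ?_ (integral_dual_le hq
    (hφ.memLp_mul (hf.memLp_of_two_le (ofReal_two_le hq))) hg)
  congr 1; ext x; rw [dualWeight]; ring

/-- The norm is convex, so it lies above its tangent at `f`. The inequality bounds differences to the past
from above, which is why left Dini derivatives appear below. -/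
theorem norm_sub_norm_le_dual (hq : 2 ≤ q) (hφ : IsBoundedWeight A φ) {f g : ℝ → ℝ}
    (hf : IsH1 f) (hg : IsH1 g) {N : ℝ} (hN : 0 < N)
    (hfN : (eLpNorm (fun x => φ x * f x) (ENNReal.ofReal q) volume).toReal = N) :
    N - (eLpNorm (fun x => φ x * g x) (ENNReal.ofReal q) volume).toReal ≤
      N ^ (1 - q) * ∫ x, dualWeight q φ f x * (f x - g x) := by
  have hJ := memLp_dualWeight hq hφ hf
  have h1 : ∫ x, dualWeight q φ f x * f x = N ^ q := by
    rw [← hfN, ← integral_abs_rpow_eq hq (hφ.memLp_mul (hf.memLp_of_two_le (ofReal_two_le hq)))]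
    congr 1; ext x; rw [dualWeight]; ring
  have h2 := integral_dualWeight_le hq hφ hf
    (hφ.memLp_mul (hg.memLp_of_two_le (ofReal_two_le hq)))
  rw [hfN] at h2
  have h3 : ∫ x, dualWeight q φ f x * (f x - g x) =
      N ^ q - ∫ x, dualWeight q φ f x * g x := by
    rw [← h1]
    refine Eq.trans ?_ (integral_sub
      (show Integrable (fun x => dualWeight q φ f x * f x) from hJ.integrable_mul hf.memLp)
      (show Integrable (fun x => dualWeight q φ f x * g x) from hJ.integrable_mul hg.memLp))
    congr 1; ext x; ring
  have h4 : N ^ (1 - q) * N ^ q = N := by rw [← Real.rpow_add hN]; simp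
  have h5 : N ^ (1 - q) * N ^ (q - 1) = 1 := by rw [← Real.rpow_add hN]; simp
  rw [h3, mul_sub, h4]
  have h6 := mul_le_mul_of_nonneg_left h2 (Real.rpow_nonneg hN.le (1 - q))
  rw [← mul_assoc, h5, one_mul] at h6
  linarith

theorem tendsto_integral_mul_of_L2 {ι : Type*} {l : Filter ι} {J a : ℝ → ℝ} {D : ι → ℝ → ℝ}
    (hJ : MemLp J 2 volume) (ha : MemLp a 2 volume) (hD : ∀ᶠ i in l, MemLp (D i) 2 volume)
    (h : Tendsto (fun i => eLpNorm (fun x => D i x - a x) 2 volume) l (𝓝 0)) :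
    Tendsto (fun i => ∫ x, J x * D i x) l (𝓝 (∫ x, J x * a x)) := by
  refine tendsto_integral_of_L1' _ (hJ.1.mul ha.1) (hD.mono fun i hi => hJ.integrable_mul hi) ?_
  have h2 : Tendsto (fun i => eLpNorm J 2 volume * eLpNorm (fun x => D i x - a x) 2 volume) l (𝓝 0) := by
    simpa using ENNReal.Tendsto.const_mul h (Or.inr hJ.2.ne)
  refine tendsto_of_tendsto_of_tendsto_of_le_of_le' tendsto_const_nhds h2
    (Eventually.of_forall fun _ => zero_le) (hD.mono fun i hi => ?_)
  have := eLpNorm_smul_le_mul_eLpNorm (p := 2) (q := 2) (r := 1) (hi.1.sub ha.1) hJ.1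
  refine le_trans (le_of_eq ?_) this
  congr 1; ext x; simp [mul_sub]

/-- The energy estimate at one time. If `f_t = -u f_x + g`, where `f_t` is the left derivative in `L²`, then the
left upper Dini derivative of `‖φf‖_q` is at most `(A + 1) M ‖φf‖_q + ‖φg‖_q`. -/
theorem eventually_slope_lt (hA : 0 ≤ A) (hq : 2 ≤ q) (hφ : IsBoundedWeight A φ) {f : ℝ → ℝ → ℝ} {t : ℝ}
    {a g u : ℝ → ℝ} (hf : IsH1 (f t)) (hf' : ∀ᶠ h in 𝓝[>] (0 : ℝ), IsH1 (f (t - h)))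
    (ha : MemLp a 2 volume)
    (hlim : Tendsto (fun h => eLpNorm (fun x => h⁻¹ * (f t x - f (t - h) x) - a x) 2 volume)
      (𝓝[>] 0) (𝓝 0))
    (hu : ∀ a b, AbsolutelyContinuousOnInterval u a b) {M : ℝ}
    (huM : ∀ x, |u x| ≤ M) (huM' : ∀ᵐ x, |deriv u x| ≤ M)
    (hg : MemLp (fun x => φ x * g x) (ENNReal.ofReal q) volume)
    (hag : ∀ᵐ x, a x = -(u x * deriv (f t) x) + g x) {r : ℝ}
    (hr : (A + 1) * M * (eLpNorm (fun x => φ x * f t x) (ENNReal.ofReal q) volume).toReal +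
      (eLpNorm (fun x => φ x * g x) (ENNReal.ofReal q) volume).toReal < r) :
    ∀ᶠ h in 𝓝[>] (0 : ℝ),
      h⁻¹ * ((eLpNorm (fun x => φ x * f t x) (ENNReal.ofReal q) volume).toReal -
        (eLpNorm (fun x => φ x * f (t - h) x) (ENNReal.ofReal q) volume).toReal) < r := by
  have hM : 0 ≤ M := (abs_nonneg _).trans (huM 0)
  set N := (eLpNorm (fun x => φ x * f t x) (ENNReal.ofReal q) volume).toReal with hN
  have hN0 : 0 ≤ N := ENNReal.toReal_nonneg
  have hr0 : 0 < r := lt_of_le_of_lt (by positivity) hr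
  -- if the norm vanishes at time `t`, then its difference to the past is nonpositive
  rcases hN0.eq_or_lt with hz | hpos
  · filter_upwards [self_mem_nhdsWithin] with h hh
    refine lt_of_le_of_lt ?_ hr0
    rw [← hz]
    refine mul_nonpos_of_nonneg_of_nonpos (inv_nonneg.2 (le_of_lt hh)) ?_
    linarith [ENNReal.toReal_nonneg (a := eLpNorm (fun x => φ x * f (t - h) x) (ENNReal.ofReal q) volume)]
  have hJ := memLp_dualWeight hq hφ hf
  have hgt : MemLp (fun x => u x * deriv (f t) x) 2 volume :=
    hf.memLp_deriv.of_le_mul (c := M) ((continuous_of_ac hu).aestronglyMeasurable.mul hf.memLp_deriv.1)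
      (Eventually.of_forall fun x => by rw [norm_mul]; gcongr; exact huM x)
  have hg2 : MemLp g 2 volume := by
    refine (memLp_congr_ae ?_).1 (ha.add hgt)
    filter_upwards [hag] with x hx
    simp [hx]
  have hlim2 : Tendsto (fun h => N ^ (1 - q) *
      ∫ x, dualWeight q φ (f t) x * (h⁻¹ * (f t x - f (t - h) x))) (𝓝[>] 0)
      (𝓝 (N ^ (1 - q) * ∫ x, dualWeight q φ (f t) x * a x)) := by
    refine (tendsto_integral_mul_of_L2 hJ ha ?_ hlim).const_mul _
    filter_upwards [hf'] with h hh
    exact (hf.memLp.sub hh.memLp).const_mul _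
  have hbound : N ^ (1 - q) * ∫ x, dualWeight q φ (f t) x * a x < r := by
    have h1 : ∫ x, dualWeight q φ (f t) x * a x =
        (∫ x, dualWeight q φ (f t) x * -(u x * deriv (f t) x)) + ∫ x, dualWeight q φ (f t) x * g x := by
      have i1 : Integrable (fun x => dualWeight q φ (f t) x * -(u x * deriv (f t) x)) :=
        hJ.integrable_mul hgt.neg
      have i2 : Integrable (fun x => dualWeight q φ (f t) x * g x) := hJ.integrable_mul hg2
      rw [← integral_add i1 i2]
      refine integral_congr_ae ?_
      filter_upwards [hag] with x hx
      simp only [hx]; ring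
    have h2 := integral_dualWeight_transport_le hq hφ hf hu huM huM'
    have h3 := integral_dualWeight_le hq hφ hf hg
    rw [← hN] at h2 h3
    have h4 : N ^ (1 - q) * N ^ q = N := by rw [← Real.rpow_add hpos]; simp
    have h5 : N ^ (1 - q) * N ^ (q - 1) = 1 := by rw [← Real.rpow_add hpos]; simp
    have hq1 : 1 / q ≤ 1 := by rw [div_le_one (by linarith)]; linarith
    refine lt_of_le_of_lt ?_ hr
    set G := (eLpNorm (fun x => φ x * g x) (ENNReal.ofReal q) volume).toReal
    calc _ ≤ N ^ (1 - q) * ((A + 1 / q) * M * N ^ q + N ^ (q - 1) * G) := by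
          rw [h1]; exact mul_le_mul_of_nonneg_left (add_le_add h2 h3) (Real.rpow_nonneg hN0 _)
      _ = (A + 1 / q) * M * (N ^ (1 - q) * N ^ q) + (N ^ (1 - q) * N ^ (q - 1)) * G := by ring
      _ = (A + 1 / q) * M * N + G := by rw [h4, h5, one_mul]
      _ ≤ (A + 1) * M * N + G := by gcongr
  filter_upwards [hlim2.eventually_lt_const hbound, hf', self_mem_nhdsWithin] with h h1 h2 h3
  refine lt_of_le_of_lt ?_ h1
  have h4 := mul_le_mul_of_nonneg_left (norm_sub_norm_le_dual hq hφ hf h2 hpos hN.symm)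
    (inv_nonneg.2 (le_of_lt h3 : (0 : ℝ) ≤ h))
  refine h4.trans_eq ?_
  rw [mul_left_comm, ← integral_const_mul]
  congr 2; ext x; ring

end Duality

/-! ### Convolution estimates -/

/-- Young's inequality for the convolution of a function with a finite measure. -/
theorem lintegral_convolution_rpow_le {μ : Measure ℝ} [IsFiniteMeasure μ] {h : ℝ → ℝ≥0∞}
    (hh : Measurable h) {q : ℝ} (hq : 1 < q) :
    ∫⁻ x, (∫⁻ y, h (x - y) ∂μ) ^ q ≤ μ Set.univ ^ q * ∫⁻ x, h x ^ q := by
  have hq0 : 0 < q := by linarith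
  have hconj : q.HolderConjugate (q / (q - 1)) := by
    rw [Real.holderConjugate_iff]
    exact ⟨by linarith, by field_simp; ring⟩
  have hpt : ∀ x, (∫⁻ y, h (x - y) ∂μ) ^ q ≤ μ Set.univ ^ (q - 1) * ∫⁻ y, h (x - y) ^ q ∂μ := by
    intro x
    have hm : Measurable fun y => h (x - y) := hh.comp (measurable_const.sub measurable_id)
    have := ENNReal.lintegral_mul_le_Lp_mul_Lq μ hconj hm.aemeasurable
      (aemeasurable_const (b := (1 : ℝ≥0∞)))
    simp only [Pi.mul_apply, mul_one, ENNReal.one_rpow, lintegral_const, one_mul] at this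
    calc (∫⁻ y, h (x - y) ∂μ) ^ q
        ≤ ((∫⁻ y, h (x - y) ^ q ∂μ) ^ (1 / q) * μ Set.univ ^ (1 / (q / (q - 1)))) ^ q := by
          gcongr
      _ = _ := by
          rw [ENNReal.mul_rpow_of_nonneg _ _ hq0.le, ← ENNReal.rpow_mul, ← ENNReal.rpow_mul,
            one_div_mul_cancel hq0.ne', ENNReal.rpow_one, mul_comm]
          congr 2
          field_simp
  calc ∫⁻ x, (∫⁻ y, h (x - y) ∂μ) ^ q
      ≤ ∫⁻ x, μ Set.univ ^ (q - 1) * ∫⁻ y, h (x - y) ^ q ∂μ := lintegral_mono hpt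
    _ = μ Set.univ ^ (q - 1) * ∫⁻ x, ∫⁻ y, h (x - y) ^ q ∂μ :=
        lintegral_const_mul' _ _ (ENNReal.rpow_ne_top_of_nonneg (by linarith) (measure_ne_top _ _))
    _ = μ Set.univ ^ (q - 1) * ∫⁻ y, (∫⁻ x, h (x - y) ^ q) ∂μ := by
        rw [lintegral_lintegral_swap]
        exact ((hh.comp (measurable_fst.sub measurable_snd)).pow_const q).aemeasurable
    _ = μ Set.univ ^ (q - 1) * (μ Set.univ * ∫⁻ x, h x ^ q) := by
        congr 1
        simp_rw [fun y => lintegral_sub_right_eq_self (μ := volume) (fun x => h x ^ q) y]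
        rw [lintegral_const, mul_comm]
    _ = _ := by
        rw [← mul_assoc]
        congr 1
        nth_rewrite 2 [← ENNReal.rpow_one (μ Set.univ)]
        rw [← ENNReal.rpow_add_of_nonneg _ _ (by linarith) (by norm_num)]
        congr 1; ring

/-- The bounded solution of `P' = P + F` with `F ≥ 0` is `P(x) = -∫_x^∞ e^(x-y) F(y) dy`. -/
theorem ofReal_abs_le_of_ode {P F : ℝ → ℝ} {K : ℝ} (hP : ∀ x, |P x| ≤ K) (hF : ∀ x, 0 ≤ F x)
    (h : ∀ x, HasDerivAt P (P x + F x) x) (x : ℝ) :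
    ENNReal.ofReal |P x| ≤ ∫⁻ y in Set.Ioi x, ENNReal.ofReal (Real.exp (x - y) * F y) := by
  have hd : ∀ y ∈ Set.Ici x, HasDerivAt (fun y => Real.exp (x - y) * P y) (Real.exp (x - y) * F y) y := by
    intro y _
    have h1 : HasDerivAt (fun y => Real.exp (x - y)) (-Real.exp (x - y)) y := by
      simpa using ((hasDerivAt_id y).const_sub x).exp
    exact (h1.fun_mul (h y)).congr_deriv (by ring)
  have hlim : Tendsto (fun y => Real.exp (x - y) * P y) atTop (𝓝 0) := by
    have h1 : Tendsto (fun y => Real.exp (x - y)) atTop (𝓝 0) := by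
      refine Real.tendsto_exp_atBot.comp ?_
      exact (tendsto_atBot_add_const_left _ x tendsto_neg_atTop_atBot).congr
        fun y => (sub_eq_add_neg x y).symm
    refine squeeze_zero_norm (fun y => ?_) (by simpa using h1.mul_const K)
    rw [norm_mul, Real.norm_of_nonneg (Real.exp_pos _).le]
    gcongr
    exact hP y
  have hpos : ∀ y ∈ Set.Ioi x, 0 ≤ Real.exp (x - y) * F y := fun y _ =>
    mul_nonneg (Real.exp_pos _).le (hF y)
  have h1 := integral_Ioi_of_hasDerivAt_of_nonneg' hd hpos hlim
  have h2 := integrableOn_Ioi_deriv_of_nonneg' hd hpos hlim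
  rw [← ofReal_integral_eq_lintegral_ofReal h2
    ((ae_restrict_iff' measurableSet_Ioi).2 (Eventually.of_forall hpos)), h1]
  simp only [sub_self, Real.exp_zero, one_mul, zero_sub]
  have h3 : 0 ≤ -P x := by
    have := setIntegral_nonneg (μ := volume) measurableSet_Ioi hpos
    rw [h1] at this
    simpa using this
  rw [abs_of_nonpos (by linarith)]

/-- If `m' = b` and `b' = m + F` with `m`, `b` bounded and `F ≥ 0`, then `|m|` and `|b|` are at most
`½ e^(-|·|) * F`. The functions `m + b` and `m - b` (the latter reflected) solve `P' = P + F`. -/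
theorem ofReal_abs_le_of_elliptic {m b F : ℝ → ℝ} {K : ℝ} (hm : ∀ x, |m x| ≤ K) (hb : ∀ x, |b x| ≤ K)
    (hF : ∀ x, 0 ≤ F x) (hmb : ∀ x, HasDerivAt m (b x) x)
    (hbm : ∀ x, HasDerivAt b (m x + F x) x) (x : ℝ) :
    ENNReal.ofReal |b x| ≤ ∫⁻ y, ENNReal.ofReal (1 / 2 * Real.exp (-|y|)) * ENNReal.ofReal (F (x - y)) ∧
    ENNReal.ofReal |m x| ≤ ∫⁻ y, ENNReal.ofReal (1 / 2 * Real.exp (-|y|)) * ENNReal.ofReal (F (x - y)) := by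
  have hK : ∀ a b : ℝ, |a| ≤ K → |b| ≤ K → |a + b| ≤ K + K := fun a b ha hb =>
    (abs_add_le a b).trans (add_le_add ha hb)
  have h1 := ofReal_abs_le_of_ode (P := fun x => m x + b x) (F := F) (K := K + K)
    (fun x => hK _ _ (hm x) (hb x)) hF
    (fun x => ((hmb x).fun_add (hbm x)).congr_deriv (by ring)) x
  have h2 := ofReal_abs_le_of_ode (P := fun x => m (-x) + -b (-x)) (F := fun x => F (-x)) (K := K + K)
    (fun x => hK _ _ (hm _) (by rw [abs_neg]; exact hb _)) (fun x => hF _)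
    (fun x => by
      have e1 : HasDerivAt (fun x => m (-x)) (b (-x) * (-1)) x :=
        (hmb (-x)).comp x (hasDerivAt_neg x)
      have e2 : HasDerivAt (fun x => b (-x)) ((m (-x) + F (-x)) * (-1)) x :=
        (hbm (-x)).comp x (hasDerivAt_neg x)
      exact (e1.fun_add e2.fun_neg).congr_deriv (by ring)) (-x)
  simp only [neg_neg] at h2
  set Q := ∫⁻ y, ENNReal.ofReal (1 / 2 * Real.exp (-|y|)) * ENNReal.ofReal (F (x - y)) with hQ
  have hQ' : ∫⁻ y, ENNReal.ofReal (Real.exp (-|x - y|) * F y) = 2 * Q := by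
    rw [hQ, ← lintegral_sub_left_eq_self (fun y => ENNReal.ofReal (Real.exp (-|x - y|) * F y)) x,
      ← lintegral_const_mul' _ _ (by simp)]
    congr 1; ext y
    rw [← ENNReal.ofReal_mul (by positivity), show (2 : ℝ≥0∞) = ENNReal.ofReal 2 by simp,
      ← ENNReal.ofReal_mul (by norm_num)]
    simp only [sub_sub_cancel]
    congr 1; ring
  have hsum : ENNReal.ofReal |m x + b x| + ENNReal.ofReal |m x + -b x| ≤ 2 * Q := by
    rw [← hQ', ← lintegral_add_compl _ (measurableSet_Ioi (a := x))]
    refine add_le_add (h1.trans_eq ?_) (h2.trans ?_)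
    · refine setLIntegral_congr_fun measurableSet_Ioi fun y hy => ?_
      have : |x - y| = -(x - y) := abs_of_neg (by linarith [Set.mem_Ioi.1 hy])
      simp only [this, neg_neg]
    · have e : ∫⁻ y in Set.Ioi (-x), ENNReal.ofReal (Real.exp (-x - y) * F (-y)) =
          ∫⁻ y in Set.Iio x, ENNReal.ofReal (Real.exp (-x + y) * F y) := by
        rw [← lintegral_indicator measurableSet_Ioi, ← lintegral_indicator measurableSet_Iio,
          ← lintegral_neg_eq_self]
        congr 1; ext y
        simp only [Set.indicator, Set.mem_Ioi, Set.mem_Iio, neg_lt_neg_iff, neg_neg, sub_neg_eq_add]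
      rw [e]
      refine le_of_eq_of_le (setLIntegral_congr_fun measurableSet_Iio fun y hy => ?_)
        (lintegral_mono_set (fun y hy => by simp; exact le_of_lt hy))
      have : |x - y| = x - y := abs_of_pos (by linarith [Set.mem_Iio.1 hy])
      simp only [this]; congr 3; ring
  have hfin : ∀ z : ℝ, 2 * |z| ≤ |m x + b x| + |m x + -b x| → ENNReal.ofReal |z| ≤ Q := by
    intro z hz
    have h3 : 2 * ENNReal.ofReal |z| ≤ 2 * Q := by
      refine le_trans ?_ hsum
      rw [← ENNReal.ofReal_add (abs_nonneg _) (abs_nonneg _), show (2 : ℝ≥0∞) = ENNReal.ofReal 2 by simp,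
        ← ENNReal.ofReal_mul (by norm_num)]
      exact ENNReal.ofReal_le_ofReal hz
    exact (ENNReal.mul_le_mul_iff_right (by simp) (by simp)).1 h3
  constructor
  · refine hfin _ ?_
    have := abs_sub (m x + b x) (m x + -b x)
    rw [show m x + b x - (m x + -b x) = 2 * b x by ring, abs_mul, abs_two] at this
    exact this
  · refine hfin _ ?_
    have := abs_add_le (m x + b x) (m x + -b x)
    rw [show m x + b x + (m x + -b x) = 2 * m x by ring, abs_mul, abs_two] at this
    exact this

/-- Weighted Young inequality: as `φ(x) ≤ c v(y) φ(x - y)`, the weight passes through the convolution with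
`½ e^(-|y|)` at the cost of turning this kernel into `(c/2) v(y) e^(-|y|)`, which is integrable. -/
theorem eLpNorm_weighted_le {φ v S g : ℝ → ℝ} {c q : ℝ} (hq : 1 < q) (hφ : Continuous φ)
    (hφ0 : ∀ x, 0 < φ x) (hv : Integrable fun x => v x * Real.exp (-|x|))
    (hφv : ∀ x y, φ (x + y) ≤ c * v x * φ y) (hS : Continuous S) {α β : ℝ} (hα : 0 ≤ α) (hβ : 0 ≤ β)
    (hg : ∀ᵐ x, ENNReal.ofReal |g x| ≤ ENNReal.ofReal α * ENNReal.ofReal |S x| +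
      ENNReal.ofReal β * ∫⁻ y, ENNReal.ofReal (1 / 2 * Real.exp (-|y|)) * ENNReal.ofReal |S (x - y)|) :
    eLpNorm (fun x => φ x * g x) (ENNReal.ofReal q) volume ≤
      ENNReal.ofReal (α + β * (c / 2 * ∫ x, v x * Real.exp (-|x|))) *
        eLpNorm (fun x => φ x * S x) (ENNReal.ofReal q) volume := by
  have hq0 : 0 < q := by linarith
  have hv0 : ∀ x, 0 ≤ c * v x := fun x => by
    have := (hφ0 _).trans_le (hφv x 0)
    exact (pos_of_mul_pos_left this (hφ0 0).le).le
  set k : ℝ → ℝ≥0∞ := fun y => ENNReal.ofReal (c / 2 * (v y * Real.exp (-|y|))) with hk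
  have hkm : AEMeasurable k volume := (hv.const_mul (c / 2)).1.aemeasurable.ennreal_ofReal
  have hkint : ∫⁻ y, k y = ENNReal.ofReal (c / 2 * ∫ x, v x * Real.exp (-|x|)) := by
    rw [← integral_const_mul, ofReal_integral_eq_lintegral_ofReal (hv.const_mul _)]
    refine Eventually.of_forall fun x => ?_
    have : 0 ≤ c * v x * Real.exp (-|x|) := mul_nonneg (hv0 x) (Real.exp_pos _).le
    show 0 ≤ c / 2 * (v x * Real.exp (-|x|))
    linarith
  set μ : Measure ℝ := volume.withDensity k with hμ
  have hμu : μ Set.univ = ENNReal.ofReal (c / 2 * ∫ x, v x * Real.exp (-|x|)) := by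
    rw [hμ, withDensity_apply _ MeasurableSet.univ, Measure.restrict_univ, hkint]
  have : IsFiniteMeasure μ := ⟨by rw [hμu]; exact ENNReal.ofReal_lt_top⟩
  set h : ℝ → ℝ≥0∞ := fun x => ENNReal.ofReal |φ x * S x| with hh
  have hhm : Measurable h := (hφ.mul hS).abs.measurable.ennreal_ofReal
  have hnorm : ∀ f : ℝ → ℝ, eLpNorm f (ENNReal.ofReal q) volume =
      (∫⁻ x, ENNReal.ofReal |f x| ^ q) ^ (1 / q) := fun f => by
    rw [eLpNorm_eq_lintegral_rpow_enorm_toReal (by simpa using hq0) (by simp),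
      ENNReal.toReal_ofReal hq0.le]
    simp only [← ofReal_norm, Real.norm_eq_abs]
  have hpt : ∀ᵐ x, ENNReal.ofReal |φ x * g x| ≤ ENNReal.ofReal α * h x +
      ENNReal.ofReal β * ∫⁻ y, h (x - y) ∂μ := by
    filter_upwards [hg] with x hx
    rw [abs_mul, ENNReal.ofReal_mul (abs_nonneg _)]
    refine (mul_le_mul_right hx _).trans ?_
    rw [mul_add, mul_left_comm, mul_left_comm _ (ENNReal.ofReal β)]
    refine add_le_add (le_of_eq ?_) (mul_le_mul_right ?_ _)
    · rw [hh]; simp only; rw [abs_mul, ENNReal.ofReal_mul (abs_nonneg _)]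
    · have hxm : AEMeasurable (fun y => h (x - y)) volume :=
        (hhm.comp (measurable_const.sub measurable_id)).aemeasurable
      rw [hμ, lintegral_withDensity_eq_lintegral_mul₀ hkm hxm,
        ← lintegral_const_mul' _ _ ENNReal.ofReal_ne_top]
      refine lintegral_mono fun y => ?_
      simp only [Pi.mul_apply, hk, hh]
      rw [← ENNReal.ofReal_mul (by positivity), ← ENNReal.ofReal_mul (abs_nonneg _),
        ← ENNReal.ofReal_mul' (abs_nonneg _)]
      refine ENNReal.ofReal_le_ofReal ?_
      rw [abs_of_pos (hφ0 x), abs_mul, abs_of_pos (hφ0 _)]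
      have h1 := hφv y (x - y)
      rw [add_sub_cancel] at h1
      calc φ x * (1 / 2 * Real.exp (-|y|) * |S (x - y)|)
          ≤ (c * v y * φ (x - y)) * (1 / 2 * Real.exp (-|y|) * |S (x - y)|) := by gcongr
        _ = _ := by ring
  rw [hnorm, hnorm, ENNReal.ofReal_add hα (mul_nonneg hβ ?_), ENNReal.ofReal_mul hβ, ← hμu]
  · have hcm : Measurable fun x => ∫⁻ y, h (x - y) ∂μ :=
      (hhm.comp (measurable_fst.sub measurable_snd)).lintegral_prod_right'
    have hpull : ∀ (a : ℝ≥0∞) (f : ℝ → ℝ≥0∞), Measurable f →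
        (∫⁻ x, (a * f x) ^ q) ^ (1 / q) = a * (∫⁻ x, f x ^ q) ^ (1 / q) := fun a f hf => by
      simp_rw [ENNReal.mul_rpow_of_nonneg _ _ hq0.le]
      rw [lintegral_const_mul _ (hf.pow_const q), ENNReal.mul_rpow_of_nonneg _ _ (by positivity),
        ← ENNReal.rpow_mul, mul_one_div_cancel hq0.ne', ENNReal.rpow_one]
    calc (∫⁻ x, ENNReal.ofReal |φ x * g x| ^ q) ^ (1 / q)
        ≤ (∫⁻ x, (((fun x => ENNReal.ofReal α * h x) +
            fun x => ENNReal.ofReal β * ∫⁻ y, h (x - y) ∂μ) x) ^ q) ^ (1 / q) := by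
          gcongr ?_ ^ _
          refine lintegral_mono_ae ?_
          filter_upwards [hpt] with x hx
          exact ENNReal.rpow_le_rpow hx hq0.le
      _ ≤ (∫⁻ x, (ENNReal.ofReal α * h x) ^ q) ^ (1 / q) +
          (∫⁻ x, (ENNReal.ofReal β * ∫⁻ y, h (x - y) ∂μ) ^ q) ^ (1 / q) :=
          ENNReal.lintegral_Lp_add_le (hhm.const_mul _).aemeasurable (hcm.const_mul _).aemeasurable hq.le
      _ = ENNReal.ofReal α * (∫⁻ x, h x ^ q) ^ (1 / q) +
          ENNReal.ofReal β * (∫⁻ x, (∫⁻ y, h (x - y) ∂μ) ^ q) ^ (1 / q) := by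
          rw [hpull _ _ hhm, hpull _ _ hcm]
      _ ≤ ENNReal.ofReal α * (∫⁻ x, h x ^ q) ^ (1 / q) +
          ENNReal.ofReal β * (μ Set.univ ^ q * ∫⁻ x, h x ^ q) ^ (1 / q) := by
          gcongr
          exact lintegral_convolution_rpow_le hhm hq
      _ = _ := by
          rw [ENNReal.mul_rpow_of_nonneg _ _ (by positivity), ← ENNReal.rpow_mul,
            mul_one_div_cancel hq0.ne', ENNReal.rpow_one]
          ring
  · rw [← integral_const_mul]
    refine integral_nonneg fun x => ?_
    have : 0 ≤ c * v x * Real.exp (-|x|) := mul_nonneg (hv0 x) (Real.exp_pos _).le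
    show 0 ≤ c / 2 * (v x * Real.exp (-|x|))
    linarith

/-- Truncation preserves moderateness, since `v` is bounded below by `δ > 0`. -/
theorem moderate_min {φ v : ℝ → ℝ} {c δ : ℝ} (hφ : ∀ x, 0 < φ x) (hδ : 0 < δ) (hv : ∀ x, δ ≤ v x) (hc : 0 < c)
    (h : ∀ x y, φ (x + y) ≤ c * v x * φ y) {N : ℝ} (hN : 0 < N) (x y : ℝ) :
    min (φ (x + y)) N ≤ (c + 1 / δ) * v x * min (φ y) N := by
  have h1 : 1 ≤ 1 / δ * v x := by
    rw [one_div, ← div_eq_inv_mul, le_div_iff₀ hδ]; linarith [hv x]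
  have h2 : 0 < c * v x := mul_pos hc (hδ.trans_le (hv x))
  rw [mul_min_of_nonneg _ _ (by nlinarith)]
  refine min_le_min ((h x y).trans ?_) ?_
  · exact mul_le_mul_of_nonneg_right (by nlinarith) (hφ y).le
  · nlinarith

/-! ### The nonlocal form of the system -/

/-- An absolutely continuous function whose derivative agrees almost everywhere with a continuous function is
differentiable everywhere. -/
theorem hasDerivAt_of_ac {m b : ℝ → ℝ} (hm : ∀ a b, AbsolutelyContinuousOnInterval m a b)
    (hb : Continuous b) (h : ∀ᵐ x, deriv m x = b x) (x : ℝ) : HasDerivAt m (b x) x := by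
  have h1 : ∀ x, m x = m 0 + ∫ t in 0..x, b t := fun x => by
    rw [← intervalIntegral.integral_congr_ae (h.mono fun _ h _ => h),
      (hm 0 x).integral_deriv_eq_sub]; ring
  have := (intervalIntegral.integral_hasDerivAt_right (hb.intervalIntegrable 0 x)
    (hb.stronglyMeasurableAtFilter _ _) hb.continuousAt).const_add (m 0)
  exact this.congr_of_eventuallyEq (Eventually.of_forall h1)

/-- `|g| ≤ 6M |S| + M (½ e^(-|·|) * |S|)` almost everywhere. The inequality is stated in `[0, ∞]`, where the
convolution needs no integrability. -/
def IsControlled (M : ℝ) (S g : ℝ → ℝ) : Prop :=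
  ∀ᵐ x, ENNReal.ofReal |g x| ≤ ENNReal.ofReal (6 * M) * ENNReal.ofReal |S x| +
    ENNReal.ofReal M * ∫⁻ y, ENNReal.ofReal (1 / 2 * Real.exp (-|y|)) * ENNReal.ofReal |S (x - y)|

theorem isControlled_of_le {M : ℝ} (hM : 0 ≤ M) {S g X F : ℝ → ℝ} (hS : ∀ x, 0 ≤ S x)
    (hF : ∀ x, F x ≤ M * S x)
    (hX : ∀ x, ENNReal.ofReal |X x| ≤
      ∫⁻ y, ENNReal.ofReal (1 / 2 * Real.exp (-|y|)) * ENNReal.ofReal (F (x - y)))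
    (hg : ∀ᵐ x, |g x| ≤ |X x| + 6 * M * S x) : IsControlled M S g := by
  filter_upwards [hg] with x hx
  refine (ENNReal.ofReal_le_ofReal hx).trans ?_
  rw [ENNReal.ofReal_add (abs_nonneg _) (by have := hS x; positivity),
    ENNReal.ofReal_mul (by positivity), add_comm, abs_of_nonneg (hS x)]
  refine add_le_add le_rfl ((hX x).trans ?_)
  rw [← lintegral_const_mul' _ _ ENNReal.ofReal_ne_top]
  refine lintegral_mono fun y => ?_
  rw [mul_left_comm, ← ENNReal.ofReal_mul hM, abs_of_nonneg (hS _)]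
  gcongr
  exact hF _

/-- With `b = u_t + u u_x` and `F = u² + u_x²/2 + ρ²/2` the first equation reads `b - b_xx = -F_x`, so that
`m = b_x - F` satisfies `m_x = b` and `b_x = m + F`. This bounds the forcing terms of the transport equations of
`u`, `u_x` and `u_xx` without loss of derivatives; those of `ρ` and `ρ_x` are algebraic. Here `a = u_t` and
`r = ρ_t` at a fixed time. -/
theorem forcing_isControlled {u a ρ r : ℝ → ℝ} {M : ℝ}
    (hu : IsH1 u) (hu' : ContDiff ℝ 1 u) (hv : IsH1 (deriv u)) (hv' : ContDiff ℝ 1 (deriv u))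
    (hw : IsH1 (iteratedDeriv 2 u))
    (ha : IsH1 a) (ha' : ContDiff ℝ 1 a) (hda : IsH1 (deriv a))
    (hρ : IsH1 ρ) (hρ' : ContDiff ℝ 1 ρ) (hη : IsH1 (deriv ρ)) (hr : Continuous r)
    (eq1 : ∀ᵐ x, a x - iteratedDeriv 2 a x = u x * iteratedDeriv 3 u x +
      2 * deriv u x * iteratedDeriv 2 u x - 3 * u x * deriv u x - ρ x * deriv ρ x)
    (eq2 : ∀ᵐ x, r x = -deriv (fun y => ρ y * u y) x)
    (hM1 : ∀ x, |u x| ≤ M) (hM2 : ∀ x, |deriv u x| ≤ M) (hM3 : ∀ x, |iteratedDeriv 2 u x| ≤ M)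
    (hM4 : ∀ x, |ρ x| ≤ M) (hM5 : ∀ x, |deriv ρ x| ≤ M) {S : ℝ → ℝ}
    (hS : S = fun x => |u x| + |deriv u x| + |iteratedDeriv 2 u x| + |ρ x| + |deriv ρ x|) :
    IsControlled M S (fun x => a x + u x * deriv u x) ∧
    IsControlled M S (fun x => deriv a x + u x * deriv (deriv u) x) ∧
    IsControlled M S (fun x => iteratedDeriv 2 a x + u x * deriv (iteratedDeriv 2 u) x) ∧
    IsControlled M S (fun x => r x + u x * deriv ρ x) ∧
    IsControlled M S (fun x => deriv r x + u x * deriv (deriv ρ) x) := by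
  have hM : 0 ≤ M := (abs_nonneg _).trans (hM1 0)
  have e2 : ∀ f : ℝ → ℝ, iteratedDeriv 2 f = deriv (deriv f) := fun f => by
    rw [iteratedDeriv_succ, iteratedDeriv_one]
  have e3 : iteratedDeriv 3 u = deriv (deriv (deriv u)) := by rw [iteratedDeriv_succ, e2]
  simp only [e2, e3] at *
  have hS0 : ∀ x, 0 ≤ S x := fun x => by rw [hS]; positivity
  have dU : ∀ x, HasDerivAt u (deriv u x) x := fun x => (hu'.differentiable (by simp) x).hasDerivAt
  have dV : ∀ x, HasDerivAt (deriv u) (deriv (deriv u) x) x := fun x =>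
    (hv'.differentiable (by simp) x).hasDerivAt
  have dA : ∀ x, HasDerivAt a (deriv a x) x := fun x => (ha'.differentiable (by simp) x).hasDerivAt
  have dR : ∀ x, HasDerivAt ρ (deriv ρ x) x := fun x => (hρ'.differentiable (by simp) x).hasDerivAt
  set F : ℝ → ℝ := fun x => u x * u x + 1 / 2 * (deriv u x * deriv u x) + 1 / 2 * (ρ x * ρ x) with hF
  set b : ℝ → ℝ := fun x => a x + u x * deriv u x with hb
  set b' : ℝ → ℝ := fun x => deriv a x + (deriv u x * deriv u x + u x * deriv (deriv u) x) with hb'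
  set m : ℝ → ℝ := fun x => b' x - F x with hm
  have hbder : ∀ x, HasDerivAt b (m x + F x) x := fun x =>
    ((dA x).fun_add ((dU x).fun_mul (dV x))).congr_deriv (by simp only [hm, hb']; ring)
  have hFd : ∀ x, HasDerivAt F (2 * u x * deriv u x + deriv u x * deriv (deriv u) x + ρ x * deriv ρ x) x :=
    fun x => ((((dU x).fun_mul (dU x)).fun_add (((dV x).fun_mul (dV x)).const_mul (1 / 2))).fun_add
      (((dR x).fun_mul (dR x)).const_mul (1 / 2))).congr_deriv (by ring)
  have hFac : ∀ x y, AbsolutelyContinuousOnInterval F x y := fun x y =>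
    (((hu.ac x y).fun_mul (hu.ac x y)).add (((hv.ac x y).fun_mul (hv.ac x y)).const_mul (1 / 2))).add
      (((hρ.ac x y).fun_mul (hρ.ac x y)).const_mul (1 / 2))
  have hb'ac : ∀ x y, AbsolutelyContinuousOnInterval b' x y := fun x y =>
    (hda.ac x y).add (((hv.ac x y).fun_mul (hv.ac x y)).add ((hu.ac x y).fun_mul (hw.ac x y)))
  have hmac : ∀ x y, AbsolutelyContinuousOnInterval m x y := fun x y => (hb'ac x y).sub (hFac x y)
  have hbc : Continuous b := ha.continuous.add (hu.continuous.mul hv.continuous)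
  have hmae : ∀ᵐ x, deriv m x = b x := by
    filter_upwards [eq1, ae_differentiableAt_of_ac hda.ac, ae_differentiableAt_of_ac hw.ac] with x h1 h2 h3
    have h4 : HasDerivAt m _ x := (h2.hasDerivAt.fun_add (((dV x).fun_mul (dV x)).fun_add
      ((dU x).fun_mul h3.hasDerivAt))).fun_sub (hFd x)
    rw [h4.deriv]
    simp only [hb]
    linear_combination -h1
  -- `m_x = b` holds everywhere, so `m`, unlike `u_txx`, is a classical solution
  have hmder := hasDerivAt_of_ac hmac hbc hmae
  obtain ⟨K1, hK1, hk1⟩ := ha.exists_bound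
  obtain ⟨K2, hK2, hk2⟩ := hda.exists_bound
  have hF0 : ∀ x, 0 ≤ F x := fun x => by
    have := mul_self_nonneg (u x); have := mul_self_nonneg (deriv u x); have := mul_self_nonneg (ρ x)
    simp only [hF]; linarith
  have habs : ∀ y z : ℝ, |y| ≤ M → |y * z| ≤ M * |z| := fun y z h => by
    rw [abs_mul]; gcongr
  have hFS : ∀ x, F x ≤ M * S x := fun x => by
    have h1 := (le_abs_self _).trans (habs _ (u x) (hM1 x))
    have h2 := (le_abs_self _).trans (habs _ (deriv u x) (hM2 x))
    have h3 := (le_abs_self _).trans (habs _ (ρ x) (hM4 x))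
    have := mul_nonneg hM (abs_nonneg (u x)); have := mul_nonneg hM (abs_nonneg (deriv u x))
    have := mul_nonneg hM (abs_nonneg (deriv (deriv u) x))
    have := mul_nonneg hM (abs_nonneg (ρ x)); have := mul_nonneg hM (abs_nonneg (deriv ρ x))
    simp only [hF, hS]; linarith
  have hFK : ∀ x, F x ≤ M * (5 * M) := fun x => (hFS x).trans (by
    gcongr
    simp only [hS]; linarith [hM1 x, hM2 x, hM3 x, hM4 x, hM5 x])
  have hMM : 0 ≤ M * M := mul_nonneg hM hM
  have hbK : ∀ x, |b x| ≤ K1 + K2 + 7 * (M * M) := fun x => by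
    have h1 := (habs _ (deriv u x) (hM1 x)).trans (mul_le_mul_of_nonneg_left (hM2 x) hM)
    exact (abs_add_le _ _).trans (by linarith [hk1 x])
  have hmK : ∀ x, |m x| ≤ K1 + K2 + 7 * (M * M) := fun x => by
    have h1 := (habs _ (deriv u x) (hM2 x)).trans (mul_le_mul_of_nonneg_left (hM2 x) hM)
    have h2 := (habs _ (deriv (deriv u) x) (hM1 x)).trans (mul_le_mul_of_nonneg_left (hM3 x) hM)
    have h3 := hk2 x
    have h4 := hFK x
    have h5 := hF0 x
    rw [abs_le] at h1 h2 h3 ⊢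
    simp only [hm, hb']
    constructor <;> linarith
  have hell := ofReal_abs_le_of_elliptic hmK hbK hF0 hmder hbder
  have hctl := @isControlled_of_le M hM S
  have hzero : ∀ x, ENNReal.ofReal |(fun _ => 0 : ℝ → ℝ) x| ≤
      ∫⁻ y, ENNReal.ofReal (1 / 2 * Real.exp (-|y|)) * ENNReal.ofReal (F (x - y)) := fun x => by simp
  have hpos : ∀ x, 0 ≤ M * |u x| ∧ 0 ≤ M * |deriv u x| ∧ 0 ≤ M * |deriv (deriv u) x| ∧ 0 ≤ M * |ρ x| ∧
      0 ≤ M * |deriv ρ x| := fun x => ⟨by positivity, by positivity, by positivity, by positivity, by positivity⟩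
  have hSx : ∀ x, 6 * M * S x = 6 * (M * |u x|) + 6 * (M * |deriv u x|) + 6 * (M * |deriv (deriv u) x|) +
      6 * (M * |ρ x|) + 6 * (M * |deriv ρ x|) := fun x => by rw [hS]; ring
  have hrx : ∀ x, r x = -(deriv ρ x * u x + ρ x * deriv u x) := by
    have h1 : r =ᵐ[volume] fun x => -(deriv ρ x * u x + ρ x * deriv u x) := by
      filter_upwards [eq2] with x hx
      rw [hx, ((dR x).fun_mul (dU x)).deriv]
    exact congrFun ((Continuous.ae_eq_iff_eq (μ := volume) hr
      ((hη.continuous.mul hu.continuous).add (hρ.continuous.mul hv.continuous)).neg).1 h1)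
  refine ⟨hctl hS0 hFS (fun x => (hell x).1) (Eventually.of_forall fun x => ?_),
    hctl hS0 hFS (fun x => (hell x).2) (Eventually.of_forall fun x => ?_),
    hctl hS0 hFS (fun x => (hell x).1) ?_, hctl hS0 hFS hzero (Eventually.of_forall fun x => ?_),
    hctl hS0 hFS hzero ?_⟩
  · have : 0 ≤ 6 * M * S x := by have := hS0 x; positivity
    linarith
  · have h1 : deriv a x + u x * deriv (deriv u) x = m x + (F x - deriv u x * deriv u x) := by
      simp only [hm, hb']; ring
    rw [h1]
    refine (abs_add_le _ _).trans (add_le_add le_rfl ?_)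
    have h2 := habs _ (deriv u x) (hM2 x)
    have h3 := hFS x
    have h4 := hF0 x
    obtain ⟨p1, p2, p3, p4, p5⟩ := hpos x
    have h5 := hSx x
    rw [abs_le] at h2 ⊢
    constructor <;> linarith
  · filter_upwards [hmae, eq1] with x h0 h1
    have h1 : deriv (deriv a) x + u x * deriv (deriv (deriv u)) x = b x +
        (2 * (u x * deriv u x) + deriv u x * deriv (deriv u) x + ρ x * deriv ρ x
          - 3 * (deriv u x * deriv (deriv u) x)) := by
      simp only [hb]
      linear_combination -h1
    rw [h1]
    refine (abs_add_le _ _).trans (add_le_add le_rfl ?_)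
    have h2 := habs _ (deriv u x) (hM1 x)
    have h3 := habs _ (deriv (deriv u) x) (hM2 x)
    have h4 := habs _ (deriv ρ x) (hM4 x)
    obtain ⟨p1, p2, p3, p4, p5⟩ := hpos x
    rw [hSx x]
    rw [abs_le] at h2 h3 h4 ⊢
    constructor <;> linarith
  · have h1 : r x + u x * deriv ρ x = -(deriv u x * ρ x) := by rw [hrx]; ring
    rw [h1, abs_neg, hSx x]
    have h2 := habs _ (ρ x) (hM2 x)
    obtain ⟨p1, p2, p3, p4, p5⟩ := hpos x
    simp only [abs_zero]
    linarith
  · filter_upwards [ae_differentiableAt_of_ac hη.ac] with x hx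
    have h0 : HasDerivAt r _ x := (((hx.hasDerivAt.fun_mul (dU x)).fun_add
      ((dR x).fun_mul (dV x))).fun_neg).congr_of_eventuallyEq (Eventually.of_forall hrx)
    have h1 : deriv r x + u x * deriv (deriv ρ) x =
        -(2 * (deriv u x * deriv ρ x) + ρ x * deriv (deriv u) x) := by rw [h0.deriv]; ring
    rw [h1, abs_neg, hSx x]
    have h2 := habs _ (deriv ρ x) (hM2 x)
    have h3 := habs _ (deriv (deriv u) x) (hM4 x)
    obtain ⟨p1, p2, p3, p4, p5⟩ := hpos x
    simp only [abs_zero]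
    rw [abs_le] at h2 h3 ⊢
    constructor <;> linarith

/-! ### Families of functions depending on time -/

/-- Grönwall's inequality for the sum of a family of functions, with bounds for the left Dini
derivatives. -/
theorem sum_le_exp_mul_sum {ι : Type*} [Fintype ι] {y : ι → ℝ → ℝ} {K t₀ : ℝ} (ht₀ : 0 ≤ t₀)
    (hy : ∀ i, ContinuousOn (y i) (Set.Icc 0 t₀))
    (hB : ∀ t, 0 < t → t ≤ t₀ → ∃ B : ι → ℝ, ∑ i, B i ≤ K * ∑ i, y i t ∧
      ∀ i r, B i < r → ∀ᶠ h in 𝓝[>] (0 : ℝ), h⁻¹ * (y i t - y i (t - h)) < r) :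
    ∑ i, y i t₀ ≤ Real.exp (K * t₀) * ∑ i, y i 0 := by
  -- under time reversal left derivatives of `y` become right derivatives of `G`
  set G : ℝ → ℝ := fun τ => -∑ i, y i (t₀ - τ) with hG
  have hGc : ContinuousOn G (Set.Icc 0 t₀) := by
    refine (continuousOn_finsetSum _ fun i _ => (hy i).comp (by fun_prop) ?_).neg
    intro τ hτ
    exact ⟨by linarith [hτ.2], by linarith [hτ.1]⟩
  have hmain := le_gronwallBound_of_liminf_deriv_right_le (f := G) (f' := fun τ => -K * G τ)
    (δ := G 0) (K := -K) (ε := 0) hGc ?_ le_rfl (fun x _ => by simp) t₀ ⟨ht₀, le_rfl⟩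
  · rw [gronwallBound_ε0] at hmain
    simp only [hG, sub_self, sub_zero] at hmain
    have h1 : (∑ i, y i t₀) * Real.exp (-K * t₀) ≤ ∑ i, y i 0 := by linarith
    calc ∑ i, y i t₀ = Real.exp (K * t₀) * ((∑ i, y i t₀) * Real.exp (-K * t₀)) := by
          rw [mul_comm (∑ i, y i t₀), ← mul_assoc, ← Real.exp_add]; simp
      _ ≤ _ := by gcongr
  · intro x hx r hr
    obtain ⟨B, hBs, hBe⟩ := hB (t₀ - x) (by linarith [hx.2]) (by linarith [hx.1])
    have hr' : ∑ i, B i < r := by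
      refine lt_of_le_of_lt (hBs.trans_eq ?_) hr
      simp only [hG]; ring
    set ε := (r - ∑ i, B i) / (Fintype.card ι + 1) with hε
    have hε0 : 0 < ε := div_pos (by linarith) (by positivity)
    have hall : ∀ᶠ h in 𝓝[>] (0 : ℝ), ∀ i, h⁻¹ * (y i (t₀ - x) - y i (t₀ - x - h)) < B i + ε :=
      eventually_all.2 fun i => hBe i _ (by linarith)
    have htend : Tendsto (fun z => z - x) (𝓝[>] x) (𝓝[>] 0) := by
      refine tendsto_nhdsWithin_iff.2 ⟨?_, ?_⟩
      · have : Tendsto (fun z => z - x) (𝓝 x) (𝓝 (x - x)) := by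
          exact (continuous_id.sub continuous_const).tendsto x
        rw [sub_self] at this
        exact this.mono_left nhdsWithin_le_nhds
      · filter_upwards [self_mem_nhdsWithin] with z hz
        exact Set.mem_Ioi.2 (sub_pos.2 (Set.mem_Ioi.1 hz))
    refine ((htend.eventually hall).mono fun z hz => ?_).frequently
    have h1 : (z - x)⁻¹ * (G z - G x) =
        ∑ i, (z - x)⁻¹ * (y i (t₀ - x) - y i (t₀ - x - (z - x))) := by
      rw [← Finset.mul_sum, Finset.sum_sub_distrib]
      simp only [hG, sub_sub, add_sub_cancel]
      ring
    rw [h1]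
    calc ∑ i, (z - x)⁻¹ * (y i (t₀ - x) - y i (t₀ - x - (z - x)))
        ≤ ∑ i, (B i + ε) := Finset.sum_le_sum fun i _ => (hz i).le
      _ = ∑ i, B i + Fintype.card ι * ε := by simp [Finset.sum_add_distrib]
      _ < ∑ i, B i + (Fintype.card ι + 1) * ε := by linarith
      _ = r := by rw [hε]; field_simp; ring

theorem continuousOn_toReal_eLpNorm {J : Set ℝ} {F : ℝ → ℝ → ℝ} {p : ℝ≥0∞} (hp : 1 ≤ p)
    (hF : ∀ t ∈ J, MemLp (F t) p volume)
    (h : ∀ t₀ ∈ J, Tendsto (fun t => eLpNorm (fun x => F t x - F t₀ x) p volume) (𝓝[J] t₀) (𝓝 0)) :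
    ContinuousOn (fun t => (eLpNorm (F t) p volume).toReal) J := by
  intro t₀ ht₀
  rw [ContinuousWithinAt, tendsto_iff_dist_tendsto_zero]
  have h1 : Tendsto (fun t => (eLpNorm (fun x => F t x - F t₀ x) p volume).toReal) (𝓝[J] t₀) (𝓝 0) := by
    have := (ENNReal.tendsto_toReal ENNReal.zero_ne_top).comp (h t₀ ht₀)
    simpa [Function.comp_def] using this
  have htri : ∀ f g : ℝ → ℝ, MemLp f p volume → MemLp g p volume →
      (eLpNorm f p volume).toReal ≤ (eLpNorm g p volume).toReal +
        (eLpNorm (fun x => f x - g x) p volume).toReal := fun f g hf hg => by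
    have hfg : MemLp (fun x => f x - g x) p volume := hf.sub hg
    rw [← ENNReal.toReal_add hg.2.ne hfg.2.ne]
    refine ENNReal.toReal_mono (ENNReal.add_lt_top.2 ⟨hg.2, hfg.2⟩).ne ?_
    have := eLpNorm_add_le hg.1 hfg.1 hp
    refine le_of_eq_of_le ?_ this
    congr 1; ext x; simp
  refine squeeze_zero' (Eventually.of_forall fun _ => dist_nonneg) ?_ h1
  filter_upwards [self_mem_nhdsWithin] with t ht
  have h2 := htri _ _ (hF t ht) (hF t₀ ht₀)
  have h3 := htri _ _ (hF t₀ ht₀) (hF t ht)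
  have h4 : eLpNorm (fun x => F t₀ x - F t x) p volume = eLpNorm (fun x => F t x - F t₀ x) p volume := by
    rw [← eLpNorm_neg]; congr 1; ext x; simp
  rw [h4] at h3
  rw [Real.dist_eq, abs_le]
  constructor <;> linarith

section Families

variable {I : Set ℝ} {s : ℝ} {w w' : ℝ → ℝ → ℝ}

theorem ContHs.isH1 (h : ContHs I s w) (hs : 1 ≤ s) {t : ℝ} (ht : t ∈ I) : IsH1 (w t) :=
  (h.mem t ht).isH1 hs (h.continuous t ht)

theorem ContHs.contDiff_one (h : ContHs I s w) (hs : 2 ≤ s) {t : ℝ} (ht : t ∈ I) :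
    ContDiff ℝ 1 (w t) :=
  (h.mem t ht).contDiff_one hs (h.continuous t ht)

theorem ContHs.deriv (h : ContHs I s w) (hs : 2 ≤ s) : ContHs I (s - 1) (fun t => deriv (w t)) where
  continuous t ht := (h.contDiff_one hs ht).continuous_deriv_one
  mem t ht := (h.mem t ht).deriv (by linarith) (h.continuous t ht)
  tendsto t₀ ht₀ := by
    refine tendsto_of_tendsto_of_tendsto_of_le_of_le' tendsto_const_nhds (h.tendsto t₀ ht₀)
      (Eventually.of_forall fun _ => zero_le) ?_
    filter_upwards [self_mem_nhdsWithin] with t ht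
    have h1 := (h.contDiff_one hs ht).differentiable one_ne_zero
    have h2 := (h.contDiff_one hs ht₀).differentiable one_ne_zero
    have h3 : _root_.deriv (fun x => w t x - w t₀ x) =
        fun x => _root_.deriv (w t) x - _root_.deriv (w t₀) x :=
      funext fun x => ((h1 x).hasDerivAt.fun_sub (h2 x).hasDerivAt).deriv
    rw [← h3]
    exact sobolevNorm_deriv_le (by linarith) ((h.continuous t ht).sub (h.continuous t₀ ht₀))

theorem ContHs.tendsto_eLpNorm (h : ContHs I s w) (hs : 1 ≤ s) {p : ℝ≥0∞} (hp : 2 ≤ p) {t₀ : ℝ}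
    (ht₀ : t₀ ∈ I) :
    Tendsto (fun t => eLpNorm (fun x => w t x - w t₀ x) p volume) (𝓝[I] t₀) (𝓝 0) := by
  have h1 : Tendsto (fun t => 4 * sobolevNorm s (fun x => w t x - w t₀ x)) (𝓝[I] t₀) (𝓝 0) := by
    simpa using ENNReal.Tendsto.const_mul (h.tendsto t₀ ht₀) (Or.inr (by simp))
  refine tendsto_of_tendsto_of_tendsto_of_le_of_le' tendsto_const_nhds h1
    (Eventually.of_forall fun _ => zero_le) ?_
  filter_upwards [self_mem_nhdsWithin] with t ht
  exact eLpNorm_le_mul_sobolevNorm hs ((h.continuous t ht).sub (h.continuous t₀ ht₀)) hp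

theorem ContHs.continuousOn_weighted (h : ContHs I s w) (hs : 1 ≤ s) {p : ℝ≥0∞} (hp : 2 ≤ p)
    {A : ℝ} {φ : ℝ → ℝ} (hφ : IsBoundedWeight A φ) :
    ContinuousOn (fun t => (eLpNorm (fun x => φ x * w t x) p volume).toReal) I := by
  refine continuousOn_toReal_eLpNorm (F := fun t x => φ x * w t x) (le_trans (by norm_num) hp)
    (fun t ht => hφ.memLp_mul ((h.isH1 hs ht).memLp_of_two_le hp)) fun t₀ ht₀ => ?_
  obtain ⟨N, hN⟩ := hφ.bdd
  have h1 : Tendsto (fun t => ENNReal.ofReal N * eLpNorm (fun x => w t x - w t₀ x) p volume)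
      (𝓝[I] t₀) (𝓝 0) := by
    simpa using ENNReal.Tendsto.const_mul (h.tendsto_eLpNorm hs hp ht₀) (Or.inr (by simp))
  refine tendsto_of_tendsto_of_tendsto_of_le_of_le tendsto_const_nhds h1 (fun _ => zero_le) fun t => ?_
  refine eLpNorm_le_mul_eLpNorm_of_ae_le_mul (Eventually.of_forall fun x => ?_) p
  rw [← mul_sub, norm_mul, Real.norm_of_nonneg (hφ.pos x).le]
  gcongr
  exact hN x

/-- `a` is the left derivative of `w` at the time `t` with respect to the norm of `L²`. -/
def HasLeftDerivL2 (w : ℝ → ℝ → ℝ) (t : ℝ) (a : ℝ → ℝ) : Prop :=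
  Tendsto (fun h => eLpNorm (fun x => h⁻¹ * (w t x - w (t - h) x) - a x) 2 volume) (𝓝[>] 0) (𝓝 0)

theorem tendsto_left {t : ℝ} (ht : ∀ᶠ h in 𝓝[>] (0 : ℝ), t - h ∈ I) :
    Tendsto (fun h => t - h) (𝓝[>] 0) (𝓝[I \ {t}] t) := by
  refine tendsto_nhdsWithin_iff.2 ⟨?_, ?_⟩
  · have : Tendsto (fun h : ℝ => t - h) (𝓝 0) (𝓝 (t - 0)) :=
      (continuous_const.sub continuous_id).tendsto 0
    rw [sub_zero] at this
    exact this.mono_left nhdsWithin_le_nhds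
  · filter_upwards [ht, self_mem_nhdsWithin] with h h1 h2
    refine ⟨h1, fun h3 => ?_⟩
    have := Set.mem_Ioi.1 h2
    have := Set.mem_singleton_iff.1 h3
    linarith

/-- Convergence of difference quotients in `H^s` gives a left derivative in `L²` for every family `f` whose
difference quotients are controlled by those of `w`. -/
theorem hasLeftDerivL2_of_le {t : ℝ} (ht : ∀ᶠ h in 𝓝[>] (0 : ℝ), t - h ∈ I) {f : ℝ → ℝ → ℝ} {a : ℝ → ℝ}
    (h : HasContDerivHs I s w w') (hta : t ∈ I)
    (hle : ∀ t₁ ∈ I, eLpNorm (fun x => (t₁ - t)⁻¹ * (f t₁ x - f t x) - a x) 2 volume ≤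
      sobolevNorm s (fun x => (t₁ - t)⁻¹ * (w t₁ x - w t x) - w' t x)) :
    HasLeftDerivL2 f t a := by
  have h1 := (h.tendsto t hta).comp (tendsto_left ht)
  refine tendsto_of_tendsto_of_tendsto_of_le_of_le' tendsto_const_nhds h1
    (Eventually.of_forall fun _ => zero_le) ?_
  filter_upwards [ht] with k hk
  refine le_of_eq_of_le ?_ (hle _ hk)
  congr 1; ext x
  have : t - k - t = -k := by ring
  rw [this, inv_neg]; ring

theorem HasContDerivHs.hasLeftDerivL2 (h : HasContDerivHs I s w w') (hs : 0 ≤ s) {t : ℝ}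
    (hta : t ∈ I) (ht : ∀ᶠ h in 𝓝[>] (0 : ℝ), t - h ∈ I) : HasLeftDerivL2 w t (w' t) :=
  hasLeftDerivL2_of_le ht h hta fun _ _ => eLpNorm_le_sobolevNorm hs _

/-- Time and space derivatives commute. The regularity `s ≥ 1` of `w'` suffices, and `w t` is `C¹` by
assumption; this covers `u_xx` and `ρ_x`, for which one order less is available than in
`HasContDerivHs.deriv`. -/
theorem HasContDerivHs.hasLeftDerivL2_deriv (h : HasContDerivHs I s w w') (hs : 1 ≤ s)
    (hw : ∀ t ∈ I, ContDiff ℝ 1 (w t)) {t : ℝ}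
    (hta : t ∈ I) (ht : ∀ᶠ h in 𝓝[>] (0 : ℝ), t - h ∈ I) :
    HasLeftDerivL2 (fun t => deriv (w t)) t (deriv (w' t)) := by
  refine hasLeftDerivL2_of_le ht h hta fun t₁ ht₁ => ?_
  have hc : Continuous (fun x => (t₁ - t)⁻¹ * (w t₁ x - w t x) - w' t x) :=
    (continuous_const.mul ((h.cont.continuous t₁ ht₁).sub (h.cont.continuous t hta))).sub
      (h.cont_deriv.continuous t hta)
  refine le_trans (le_of_eq ?_) ((eLpNorm_le_sobolevNorm (by linarith) _).trans
    (sobolevNorm_deriv_le hs hc))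
  refine eLpNorm_congr_ae ?_
  filter_upwards [ae_differentiableAt_of_ac (h.cont_deriv.isH1 hs hta).ac] with x hx
  have h1 := ((hw t₁ ht₁).differentiable one_ne_zero x).hasDerivAt
  have h2 := ((hw t hta).differentiable one_ne_zero x).hasDerivAt
  exact (((h1.fun_sub h2).const_mul (t₁ - t)⁻¹).fun_sub hx.hasDerivAt).deriv.symm

theorem HasContDerivHs.deriv (h : HasContDerivHs I s w w') (hs : 2 ≤ s) :
    HasContDerivHs I (s - 1) (fun t => deriv (w t)) (fun t => deriv (w' t)) where
  cont := h.cont.deriv hs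
  cont_deriv := h.cont_deriv.deriv hs
  tendsto t₀ ht₀ := by
    refine tendsto_of_tendsto_of_tendsto_of_le_of_le' tendsto_const_nhds (h.tendsto t₀ ht₀)
      (Eventually.of_forall fun _ => zero_le) ?_
    filter_upwards [self_mem_nhdsWithin] with t ht
    have h1 := (h.cont.contDiff_one hs ht.1).differentiable one_ne_zero
    have h2 := (h.cont.contDiff_one hs ht₀).differentiable one_ne_zero
    have h3 := (h.cont_deriv.contDiff_one hs ht₀).differentiable one_ne_zero
    have h4 : _root_.deriv (fun x => (t - t₀)⁻¹ * (w t x - w t₀ x) - w' t₀ x) =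
        fun x => (t - t₀)⁻¹ * (_root_.deriv (w t) x - _root_.deriv (w t₀) x) - _root_.deriv (w' t₀) x :=
      funext fun x => ((((h1 x).hasDerivAt.fun_sub (h2 x).hasDerivAt).const_mul _).fun_sub
        (h3 x).hasDerivAt).deriv
    rw [← h4]
    exact sobolevNorm_deriv_le (by linarith) ((continuous_const.mul ((h.cont.continuous t ht.1).sub
      (h.cont.continuous t₀ ht₀))).sub (h.cont_deriv.continuous t₀ ht₀))

end Families

/-! ### Strong solutions -/

/-- The five functions `u, u_x, u_xx, ρ, ρ_x`. -/
noncomputable def fields (u ρ : ℝ → ℝ → ℝ) : Fin 5 → ℝ → ℝ → ℝ :=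
  ![u, fun t => deriv (u t), fun t => iteratedDeriv 2 (u t), ρ, fun t => deriv (ρ t)]

theorem weightedNorm_eq_sum (φ : ℝ → ℝ) (p : ℝ≥0∞) (u ρ : ℝ → ℝ → ℝ) (t : ℝ) :
    weightedNorm φ p (u t) (ρ t) =
      ∑ i, eLpNorm (fun x => φ x * fields u ρ i t x) p volume := by
  rw [Fin.sum_univ_five]; rfl

theorem supBound_eq_iSup_sum (T : EReal) (u ρ : ℝ → ℝ → ℝ) :
    supBound T u ρ = ⨆ t ∈ timeInterval T, ∑ i, eLpNorm (fields u ρ i t) ∞ volume := by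
  simp only [Fin.sum_univ_five]; rfl

theorem Icc_subset_timeInterval {T : EReal} {t : ℝ} (ht : t ∈ timeInterval T) :
    Set.Icc 0 t ⊆ timeInterval T := fun _ hτ =>
  ⟨hτ.1, (EReal.coe_le_coe_iff.2 hτ.2).trans_lt ht.2⟩

theorem eventually_sub_mem_timeInterval {T : EReal} {t : ℝ} (ht : t ∈ timeInterval T) (h0 : 0 < t) :
    ∀ᶠ h in 𝓝[>] (0 : ℝ), t - h ∈ timeInterval T := by
  filter_upwards [Ioo_mem_nhdsGT h0] with h hh
  exact Icc_subset_timeInterval ht ⟨by linarith [hh.2], by linarith [hh.1]⟩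

section StrongSolution

variable {s : ℝ} {T : EReal} {u ρ : ℝ → ℝ → ℝ}

theorem IsStrongSolution.contHs_fields (h : IsStrongSolution s T u ρ) (hs : 3 < s) (i : Fin 5) :
    ∃ σ : ℝ, 1 ≤ σ ∧ ContHs (timeInterval T) σ (fields u ρ i) := by
  have h1 := h.cont_u.deriv (by linarith)
  have h2 := h1.deriv (by linarith)
  have h3 := h.cont_ρ.deriv (by linarith)
  fin_cases i
  · exact ⟨s, by linarith, h.cont_u⟩
  · exact ⟨s - 1, by linarith, h1⟩
  · refine ⟨s - 1 - 1, by linarith, ?_⟩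
    have e : fields u ρ 2 = fun t => deriv (deriv (u t)) := by
      funext t
      show iteratedDeriv 2 (u t) = _
      rw [iteratedDeriv_succ, iteratedDeriv_one]
    show ContHs _ _ (fields u ρ 2)
    rw [e]; exact h2
  · exact ⟨s - 1, by linarith, h.cont_ρ⟩
  · exact ⟨s - 1 - 1, by linarith, h3⟩

/-- Each of the five fields solves a transport equation `f_t = -u f_x + g` with controlled forcing. -/
theorem IsStrongSolution.exists_transport (h : IsStrongSolution s T u ρ) (hs : 3 < s) :
    ∃ a : Fin 5 → ℝ → ℝ → ℝ, ∀ t ∈ timeInterval T, 0 < t → ∀ M : ℝ,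
      (∀ i x, |fields u ρ i t x| ≤ M) → ∀ i, HasLeftDerivL2 (fields u ρ i) t (a i t) ∧
        MemLp (a i t) 2 volume ∧ IsControlled M (fun x => ∑ j, |fields u ρ j t x|)
          (fun x => a i t x + u t x * deriv (fields u ρ i t) x) := by
  obtain ⟨ut, ρt, hu, hρ, heq⟩ := h.equations
  have e2 : ∀ f : ℝ → ℝ, iteratedDeriv 2 f = deriv (deriv f) := fun f => by
    rw [iteratedDeriv_succ, iteratedDeriv_one]
  have hv := hu.deriv (by linarith)
  have hcv := h.cont_u.deriv (by linarith)
  have hcw := hcv.deriv (by linarith)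
  have hcη := h.cont_ρ.deriv (by linarith)
  refine ⟨![ut, fun t => deriv (ut t), fun t => iteratedDeriv 2 (ut t), ρt, fun t => deriv (ρt t)],
    fun t ht h0 M hM => ?_⟩
  have hev := eventually_sub_mem_timeInterval ht h0
  have hw1 : IsH1 (iteratedDeriv 2 (u t)) := by rw [e2]; exact hcw.isH1 (by linarith) ht
  have ha := hu.cont_deriv.isH1 (by linarith) ht
  have ha' := hv.cont_deriv.isH1 (by linarith) ht
  have hr := hρ.cont_deriv.isH1 (by linarith) ht
  obtain ⟨c1, c2, c3, c4, c5⟩ := forcing_isControlled (h.cont_u.isH1 (by linarith) ht)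
    (h.cont_u.contDiff_one (by linarith) ht) (hcv.isH1 (by linarith) ht)
    (hcv.contDiff_one (by linarith) ht) hw1 ha (hu.cont_deriv.contDiff_one (by linarith) ht) ha'
    (h.cont_ρ.isH1 (by linarith) ht) (h.cont_ρ.contDiff_one (by linarith) ht)
    (hcη.isH1 (by linarith) ht) hr.continuous (heq t ht).1 (heq t ht).2
    (hM 0) (hM 1) (hM 2) (hM 3) (hM 4) rfl
  have hS : (fun x => ∑ j, |fields u ρ j t x|) = fun x => |u t x| + |deriv (u t) x| +
      |iteratedDeriv 2 (u t) x| + |ρ t x| + |deriv (ρ t) x| := by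
    funext x; rw [Fin.sum_univ_five]; rfl
  rw [hS]
  intro i
  fin_cases i
  · exact ⟨hu.hasLeftDerivL2 (by linarith) ht hev, ha.memLp, c1⟩
  · exact ⟨hv.hasLeftDerivL2 (by linarith) ht hev, ha'.memLp, c2⟩
  · refine ⟨?_, ?_, c3⟩
    · have := hv.hasLeftDerivL2_deriv (by linarith)
        (fun t ht => hcv.contDiff_one (by linarith) ht) ht hev
      simp only [← e2] at this
      exact this
    · show MemLp (iteratedDeriv 2 (ut t)) 2 volume
      rw [e2]; exact ha'.memLp_deriv
  · exact ⟨hρ.hasLeftDerivL2 (by linarith) ht hev, hr.memLp, c4⟩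
  · exact ⟨hρ.hasLeftDerivL2_deriv (by linarith)
      (fun t ht => h.cont_ρ.contDiff_one (by linarith) ht) ht hev, hr.memLp_deriv, c5⟩

/-- The estimate for a bounded weight and a finite exponent, by Grönwall's inequality. -/
theorem IsStrongSolution.sum_toReal_le (h : IsStrongSolution s T u ρ) (hs : 3 < s) {A c q M t₀ : ℝ}
    {φ v : ℝ → ℝ} (hA : 0 ≤ A) (hq : 2 ≤ q) (hφ : IsBoundedWeight A φ)
    (hv : Integrable fun x => v x * Real.exp (-|x|)) (hφv : ∀ x y, φ (x + y) ≤ c * v x * φ y)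
    (hκ : 0 ≤ c / 2 * ∫ x, v x * Real.exp (-|x|))
    (ht₀ : t₀ ∈ timeInterval T) (hM : ∀ t ∈ Set.Icc 0 t₀, ∀ i x, |fields u ρ i t x| ≤ M) :
    ∑ i, (eLpNorm (fun x => φ x * fields u ρ i t₀ x) (ENNReal.ofReal q) volume).toReal ≤
      Real.exp ((A + 1 + 5 * (6 + c / 2 * ∫ x, v x * Real.exp (-|x|))) * M * t₀) *
        ∑ i, (eLpNorm (fun x => φ x * fields u ρ i 0 x) (ENNReal.ofReal q) volume).toReal := by
  set κ := c / 2 * ∫ x, v x * Real.exp (-|x|) with hκd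
  obtain ⟨a, ha⟩ := h.exists_transport hs
  have hI := Icc_subset_timeInterval ht₀
  have hq' : (2 : ℝ≥0∞) ≤ ENNReal.ofReal q := by
    rw [show (2 : ℝ≥0∞) = ENNReal.ofReal 2 by simp]; exact ENNReal.ofReal_le_ofReal hq
  have hH : ∀ i, ∀ t ∈ timeInterval T, IsH1 (fields u ρ i t) := fun i t ht => by
    obtain ⟨σ, hσ, hc⟩ := h.contHs_fields hs i
    exact hc.isH1 hσ ht
  have hM0 : 0 ≤ M := (abs_nonneg _).trans (hM 0 ⟨le_rfl, ht₀.1⟩ 0 0)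
  refine sum_le_exp_mul_sum
    (y := fun i t => (eLpNorm (fun x => φ x * fields u ρ i t x) (ENNReal.ofReal q) volume).toReal)
    ht₀.1 (fun i => ?_) fun t h0 ht => ?_
  · obtain ⟨σ, hσ, hc⟩ := h.contHs_fields hs i
    exact (hc.continuousOn_weighted hσ hq' hφ).mono hI
  · have htI : t ∈ timeInterval T := hI ⟨h0.le, ht⟩
    have ha := ha t htI h0 M (hM t ⟨h0.le, ht⟩)
    set y : Fin 5 → ℝ := fun i =>
      (eLpNorm (fun x => φ x * fields u ρ i t x) (ENNReal.ofReal q) volume).toReal with hy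
    set g : Fin 5 → ℝ → ℝ := fun i x => a i t x + u t x * deriv (fields u ρ i t) x with hg
    have hmem : ∀ j, MemLp (fun x => φ x * fields u ρ j t x) (ENNReal.ofReal q) volume := fun j =>
      hφ.memLp_mul ((hH j t htI).memLp_of_two_le hq')
    have hSq : eLpNorm (fun x => φ x * ∑ j, |fields u ρ j t x|) (ENNReal.ofReal q) volume ≤
        ENNReal.ofReal (∑ j, y j) := by
      have e : (fun x => φ x * ∑ j, |fields u ρ j t x|) =
          ∑ j, fun x => φ x * |fields u ρ j t x| := by
        funext x; rw [Finset.sum_apply, Finset.mul_sum]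
      rw [e]
      refine (eLpNorm_sum_le (fun j _ => ?_) (le_trans (by norm_num) hq')).trans_eq ?_
      · exact ((continuous_of_ac hφ.ac).mul (hH j t htI).continuous.abs).aestronglyMeasurable
      · rw [ENNReal.ofReal_sum_of_nonneg fun _ _ => ENNReal.toReal_nonneg]
        refine Finset.sum_congr rfl fun j _ => ?_
        rw [ENNReal.ofReal_toReal (hmem j).2.ne]
        refine eLpNorm_congr_norm_ae (Eventually.of_forall fun x => ?_)
        simp
    have hgq : ∀ i, eLpNorm (fun x => φ x * g i x) (ENNReal.ofReal q) volume ≤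
        ENNReal.ofReal ((6 + κ) * M * ∑ j, y j) := fun i => by
      refine (eLpNorm_weighted_le (by linarith) (continuous_of_ac hφ.ac) hφ.pos hv hφv
        (continuous_finsetSum _ fun j _ => (hH j t htI).continuous.abs) (by positivity) hM0
        (ha i).2.2).trans ?_
      rw [ENNReal.ofReal_mul (by positivity), show 6 * M + M * (c / 2 * ∫ x, v x * Real.exp (-|x|)) =
        (6 + κ) * M by rw [hκd]; ring]
      gcongr
    have hgm : ∀ i, MemLp (fun x => φ x * g i x) (ENNReal.ofReal q) volume := fun i =>
      ⟨(continuous_of_ac hφ.ac).aestronglyMeasurable.mul ((ha i).2.1.1.add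
        ((hH 0 t htI).continuous.aestronglyMeasurable.mul
          (measurable_deriv _).aestronglyMeasurable)),
        (hgq i).trans_lt ENNReal.ofReal_lt_top⟩
    have hy0 : ∀ j, 0 ≤ y j := fun j => ENNReal.toReal_nonneg
    refine ⟨fun i => (A + 1) * M * y i +
      (eLpNorm (fun x => φ x * g i x) (ENNReal.ofReal q) volume).toReal, ?_, fun i r hr => ?_⟩
    · rw [Finset.sum_add_distrib, ← Finset.mul_sum]
      have : ∑ i, (eLpNorm (fun x => φ x * g i x) (ENNReal.ofReal q) volume).toReal ≤
          ∑ _i : Fin 5, (6 + κ) * M * ∑ j, y j := Finset.sum_le_sum fun i _ =>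
        ENNReal.toReal_le_of_le_ofReal
          (mul_nonneg (by positivity) (Finset.sum_nonneg fun j _ => hy0 j)) (hgq i)
      simp only [Finset.sum_const, Finset.card_univ, Fintype.card_fin, nsmul_eq_mul] at this
      push_cast at this
      linarith
    · refine eventually_slope_lt hA hq hφ (hH i t htI) ?_ (ha i).2.1 (ha i).1 (hH 0 t htI).ac
        (hM t ⟨h0.le, ht⟩ 0) (Eventually.of_forall (hM t ⟨h0.le, ht⟩ 1)) (hgm i)
        (Eventually.of_forall fun x => ?_) hr
      · filter_upwards [eventually_sub_mem_timeInterval htI h0] with k hk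
        exact hH i _ hk
      · simp only [hg]
        show _ = -(u t x * _) + _
        ring

/-- A solution is bounded on compact time intervals, by a real number that does not exceed the supremum over
`[0, T)`, even if the latter is infinite. -/
theorem IsStrongSolution.exists_bound (h : IsStrongSolution s T u ρ) (hs : 3 < s) {t₀ : ℝ}
    (ht₀ : t₀ ∈ timeInterval T) :
    ∃ M : ℝ, 0 ≤ M ∧ ENNReal.ofReal M ≤ supBound T u ρ ∧
      ∀ t ∈ Set.Icc 0 t₀, ∀ i x, |fields u ρ i t x| ≤ M := by
  have hI := Icc_subset_timeInterval ht₀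
  have hH : ∀ i, ∀ t ∈ timeInterval T, IsH1 (fields u ρ i t) := fun i t ht => by
    obtain ⟨σ, hσ, hc⟩ := h.contHs_fields hs i
    exact hc.isH1 hσ ht
  have hK : ∀ i, ∃ K, ∀ t ∈ Set.Icc 0 t₀, (eLpNorm (fields u ρ i t) ∞ volume).toReal ≤ K := by
    intro i
    obtain ⟨σ, hσ, hc⟩ := h.contHs_fields hs i
    have hcont : ContinuousOn (fun t => (eLpNorm (fields u ρ i t) ∞ volume).toReal) (Set.Icc 0 t₀) :=
      (continuousOn_toReal_eLpNorm le_top (fun t ht => (hH i t ht).memLp_of_two_le le_top)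
        fun t ht => hc.tendsto_eLpNorm hσ le_top ht).mono hI
    obtain ⟨K, hK⟩ := (isCompact_Icc.image_of_continuousOn hcont).bddAbove
    exact ⟨K, fun t ht => hK ⟨t, ht, rfl⟩⟩
  choose K hK using hK
  set m : ℝ≥0∞ := ⨆ t ∈ Set.Icc 0 t₀, ∑ i, eLpNorm (fields u ρ i t) ∞ volume with hm
  have hmtop : m ≠ ∞ := by
    refine ne_top_of_le_ne_top (b := ∑ i, ENNReal.ofReal (K i)) (by simp) (iSup₂_le fun t ht => ?_)
    refine Finset.sum_le_sum fun i _ => ?_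
    rw [← ENNReal.ofReal_toReal ((hH i t (hI ht)).memLp_of_two_le le_top).2.ne]
    exact ENNReal.ofReal_le_ofReal (hK i t ht)
  refine ⟨m.toReal, ENNReal.toReal_nonneg, ?_, fun t ht i => ?_⟩
  · rw [ENNReal.ofReal_toReal hmtop, supBound_eq_iSup_sum]
    exact biSup_mono fun t ht => hI ht
  · refine abs_le_of_eLpNorm_top_le (hH i t (hI ht)).continuous ENNReal.toReal_nonneg ?_
    rw [ENNReal.ofReal_toReal hmtop]
    refine le_trans ?_ (le_iSup₂ (f := fun t (_ : t ∈ Set.Icc 0 t₀) =>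
      ∑ i, eLpNorm (fields u ρ i t) ∞ volume) t ht)
    exact Finset.single_le_sum (f := fun i => eLpNorm (fields u ρ i t) ∞ volume)
      (fun _ _ => zero_le) (Finset.mem_univ i)

end StrongSolution

/-! ### All exponents and unbounded weights -/

theorem tendsto_rpow_one_div {k : ℝ≥0∞} (h0 : k ≠ 0) (h1 : k ≠ ∞) :
    Tendsto (fun q : ℝ => k ^ (1 / q)) atTop (𝓝 1) := by
  have hk : 0 < k.toReal := ENNReal.toReal_pos h0 h1
  have h2 : Tendsto (fun q : ℝ => ENNReal.ofReal (k.toReal ^ (1 / q))) atTop (𝓝 (ENNReal.ofReal 1)) := by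
    refine ENNReal.tendsto_ofReal ?_
    have h3 := (Real.continuous_const_rpow hk.ne').tendsto 0
    rw [Real.rpow_zero] at h3
    refine h3.comp ?_
    exact tendsto_inv_atTop_zero.congr fun q => (one_div q).symm
  rw [ENNReal.ofReal_one] at h2
  refine h2.congr fun q => ?_
  rw [← ENNReal.ofReal_rpow_of_pos hk, ENNReal.ofReal_toReal h1]

theorem tendsto_mul_rpow_one_div {c k : ℝ≥0∞} (hc : c ≠ ∞) (h0 : k ≠ 0) (h1 : k ≠ ∞) :
    Tendsto (fun q : ℝ => c * k ^ (1 / q)) atTop (𝓝 c) := by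
  simpa using ENNReal.Tendsto.const_mul (tendsto_rpow_one_div h0 h1) (Or.inr hc)

/-- The `L^∞` norm of a function in `L²` is the limit of its `L^q` norms. -/
theorem tendsto_eLpNorm_atTop {f : ℝ → ℝ} (hf : MemLp f 2 volume) :
    Tendsto (fun q : ℝ => eLpNorm f (ENNReal.ofReal q) volume) atTop (𝓝 (eLpNorm f ∞ volume)) := by
  refine tendsto_order.2 ⟨fun c hc => ?_, fun c hc => ?_⟩
  · obtain ⟨b, hcb, hb⟩ := exists_between hc
    have hμ : volume {x | b ≤ ‖f x‖ₑ} ≠ 0 := fun h => by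
      have : ∀ᵐ x, ‖f x‖ₑ ≤ b := by
        rw [ae_iff]
        refine measure_mono_null (fun x hx => ?_) h
        exact (not_le.1 hx).le
      rw [eLpNorm_exponent_top] at hb
      exact hb.not_ge (essSup_le_of_ae_le _ this)
    -- only `0 < k < ∞` matters for the limit of `k^(1/q)`, hence the cut-off by `1`
    set k := min (volume {x | b ≤ ‖f x‖ₑ}) 1 with hk
    have h0 : k ≠ 0 := by simp [hk, hμ]
    have h1 : k ≠ ∞ := ne_top_of_le_ne_top ENNReal.one_ne_top (min_le_right _ _)
    filter_upwards [(tendsto_mul_rpow_one_div hb.ne_top h0 h1).eventually_const_lt hcb,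
      eventually_gt_atTop 0] with q hq hq0
    refine hq.trans_le ?_
    have h2 := mul_meas_ge_le_pow_eLpNorm' volume (p := ENNReal.ofReal q) (by simpa using hq0)
      ENNReal.ofReal_ne_top hf.1 b
    rw [ENNReal.toReal_ofReal hq0.le] at h2
    rw [← ENNReal.rpow_le_rpow_iff hq0, ENNReal.mul_rpow_of_nonneg _ _ hq0.le, ← ENNReal.rpow_mul,
      one_div_mul_cancel hq0.ne', ENNReal.rpow_one]
    refine le_trans ?_ h2
    gcongr
    exact min_le_left _ _
  · obtain ⟨b, hb, hbc⟩ := exists_between hc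
    have hb0 : b ≠ 0 := (zero_le.trans_lt hb).ne'
    have hbt : b ≠ ∞ := hbc.ne_top
    set I := ∫⁻ x, ‖f x‖ₑ ^ (2 : ℝ) with hI
    have hIt : I ≠ ∞ := by
      have := lintegral_rpow_enorm_lt_top_of_eLpNorm_lt_top (by norm_num) (by norm_num) hf.2
      simpa [hI] using this.ne
    set k := max (b ^ (-2 : ℝ) * I) 1 with hk
    have h0 : k ≠ 0 := (zero_lt_one.trans_le (le_max_right _ _)).ne'
    have h1 : k ≠ ∞ :=
      (max_lt (ENNReal.mul_lt_top (by simp [hb0, lt_top_iff_ne_top]) hIt.lt_top)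
        ENNReal.one_lt_top).ne
    filter_upwards [(tendsto_mul_rpow_one_div hbt h0 h1).eventually_lt_const hbc,
      eventually_ge_atTop 2] with q hq hq2
    have hq0 : 0 < q := by linarith
    refine lt_of_le_of_lt ?_ hq
    rw [eLpNorm_eq_lintegral_rpow_enorm_toReal (by simpa using hq0) ENNReal.ofReal_ne_top,
      ENNReal.toReal_ofReal hq0.le, one_div, ENNReal.rpow_inv_le_iff hq0,
      ENNReal.mul_rpow_of_nonneg _ _ hq0.le, ← ENNReal.rpow_mul, inv_mul_cancel₀ hq0.ne',
      ENNReal.rpow_one]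
    have hsplit : ∀ z : ℝ≥0∞, z ^ q = z ^ (q - 2) * z ^ (2 : ℝ) := fun z => by
      rw [← ENNReal.rpow_add_of_nonneg _ _ (by linarith) (by norm_num)]; ring_nf
    calc ∫⁻ x, ‖f x‖ₑ ^ q ≤ ∫⁻ x, b ^ (q - 2) * ‖f x‖ₑ ^ (2 : ℝ) := by
          refine lintegral_mono_ae ?_
          filter_upwards [ae_le_eLpNormEssSup (f := f) (μ := volume)] with x hx
          rw [← eLpNorm_exponent_top] at hx
          rw [hsplit]
          gcongr
          exact hx.trans hb.le
      _ = b ^ q * (b ^ (-2 : ℝ) * I) := by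
          rw [lintegral_const_mul' _ _ (ENNReal.rpow_ne_top_of_nonneg (by linarith) hbt),
            sub_eq_add_neg, ENNReal.rpow_add _ _ hb0 hbt, mul_assoc]
      _ ≤ b ^ q * k := by gcongr; exact le_max_left _ _

/-- The estimate for a bounded weight; `p = ∞` is the limit of finite exponents, as the constant does not
depend on the exponent. -/
theorem IsStrongSolution.sum_eLpNorm_le {s : ℝ} {T : EReal} {u ρ : ℝ → ℝ → ℝ}
    (h : IsStrongSolution s T u ρ) (hs : 3 < s) {A c M t₀ : ℝ}
    {p : ℝ≥0∞} {φ v : ℝ → ℝ} (hA : 0 ≤ A) (hp : 2 ≤ p) (hφ : IsBoundedWeight A φ)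
    (hv : Integrable fun x => v x * Real.exp (-|x|)) (hφv : ∀ x y, φ (x + y) ≤ c * v x * φ y)
    (hκ : 0 ≤ c / 2 * ∫ x, v x * Real.exp (-|x|))
    (ht₀ : t₀ ∈ timeInterval T) (hM : ∀ t ∈ Set.Icc 0 t₀, ∀ i x, |fields u ρ i t x| ≤ M) :
    ∑ i, eLpNorm (fun x => φ x * fields u ρ i t₀ x) p volume ≤
      ENNReal.ofReal (Real.exp ((A + 1 + 5 * (6 + c / 2 * ∫ x, v x * Real.exp (-|x|))) * M * t₀)) *
        ∑ i, eLpNorm (fun x => φ x * fields u ρ i 0 x) p volume := by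
  have h0 : (0 : ℝ) ∈ timeInterval T := Icc_subset_timeInterval ht₀ ⟨le_rfl, ht₀.1⟩
  have hmem : ∀ i, ∀ t ∈ timeInterval T, ∀ p : ℝ≥0∞, 2 ≤ p →
      MemLp (fun x => φ x * fields u ρ i t x) p volume := fun i t ht p hp => by
    obtain ⟨σ, hσ, hc⟩ := h.contHs_fields hs i
    exact hφ.memLp_mul ((hc.isH1 hσ ht).memLp_of_two_le hp)
  have hfin : ∀ q : ℝ, 2 ≤ q →
      ∑ i, eLpNorm (fun x => φ x * fields u ρ i t₀ x) (ENNReal.ofReal q) volume ≤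
      ENNReal.ofReal (Real.exp ((A + 1 + 5 * (6 + c / 2 * ∫ x, v x * Real.exp (-|x|))) * M * t₀)) *
        ∑ i, eLpNorm (fun x => φ x * fields u ρ i 0 x) (ENNReal.ofReal q) volume := fun q hq => by
    have hq' : (2 : ℝ≥0∞) ≤ ENNReal.ofReal q := by
      rw [show (2 : ℝ≥0∞) = ENNReal.ofReal 2 by simp]; exact ENNReal.ofReal_le_ofReal hq
    have hsum : ∀ t ∈ timeInterval T,
        ∑ i, eLpNorm (fun x => φ x * fields u ρ i t x) (ENNReal.ofReal q) volume = ENNReal.ofReal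
          (∑ i, (eLpNorm (fun x => φ x * fields u ρ i t x) (ENNReal.ofReal q) volume).toReal) :=
      fun t ht => by
        rw [ENNReal.ofReal_sum_of_nonneg fun _ _ => ENNReal.toReal_nonneg]
        exact Finset.sum_congr rfl fun i _ => (ENNReal.ofReal_toReal (hmem i t ht _ hq').2.ne).symm
    rw [hsum _ ht₀, hsum _ h0, ← ENNReal.ofReal_mul (Real.exp_pos _).le]
    exact ENNReal.ofReal_le_ofReal (h.sum_toReal_le hs hA hq hφ hv hφv hκ ht₀ hM)
  rcases eq_or_ne p ∞ with rfl | hpt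
  · have hlim : ∀ t ∈ timeInterval T, Tendsto
        (fun q : ℝ => ∑ i, eLpNorm (fun x => φ x * fields u ρ i t x) (ENNReal.ofReal q) volume) atTop
        (𝓝 (∑ i, eLpNorm (fun x => φ x * fields u ρ i t x) ∞ volume)) := fun t ht =>
      tendsto_finsetSum _ fun i _ => tendsto_eLpNorm_atTop (hmem i t ht 2 le_rfl)
    refine le_of_tendsto_of_tendsto (hlim _ ht₀)
      (ENNReal.Tendsto.const_mul (hlim _ h0) (Or.inr ENNReal.ofReal_ne_top)) ?_
    filter_upwards [eventually_ge_atTop 2] with q hq using hfin q hq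
  · rw [← ENNReal.ofReal_toReal hpt]
    exact hfin _ (by simpa using ENNReal.toReal_mono hpt hp)

theorem eLpNorm_mul_le_iSup_min {φ f : ℝ → ℝ} (hφ : Continuous φ)
    (hf : Continuous f) (p : ℝ≥0∞) :
    eLpNorm (fun x => φ x * f x) p volume ≤
      ⨆ n : ℕ, eLpNorm (fun x => min (φ x) (n + 1) * f x) p volume := by
  refine (Lp.eLpNorm_lim_le_liminf_eLpNorm (f := fun (n : ℕ) x => min (φ x) (n + 1) * f x)
    (fun n => ((hφ.min continuous_const).mul hf).aestronglyMeasurable) _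
    (Eventually.of_forall fun x => ?_)).trans ?_
  · refine tendsto_const_nhds.congr' ?_
    filter_upwards [eventually_ge_atTop ⌈φ x⌉₊] with n hn
    rw [min_eq_left]
    linarith [Nat.ceil_le.1 hn]
  · exact (liminf_le_limsup).trans limsup_le_iSup

theorem eLpNorm_mul_mono {φ ψ f : ℝ → ℝ} (hφ : ∀ x, 0 ≤ φ x) (h : ∀ x, φ x ≤ ψ x) (p : ℝ≥0∞) :
    eLpNorm (fun x => φ x * f x) p volume ≤ eLpNorm (fun x => ψ x * f x) p volume := by
  refine eLpNorm_mono fun x => ?_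
  rw [norm_mul, norm_mul, Real.norm_of_nonneg (hφ x), Real.norm_of_nonneg ((hφ x).trans (h x))]
  gcongr
  exact h x

end TwoCH

theorem theorem1 (φ : ℝ → ℝ) (hφ : TwoCH.IsAdmissible φ) :
    ∃ C : ℝ, 0 < C ∧
      ∀ (s : ℝ) (_ : 3 < s) (p : ℝ≥0∞) (_ : 2 ≤ p) (T : EReal) (_ : 0 < T) (u ρ : ℝ → ℝ → ℝ)
        (_ : TwoCH.IsStrongSolution s T u ρ)
        (_ : MemLp (fun x => φ x * u 0 x) p volume)
        (_ : MemLp (fun x => φ x * deriv (u 0) x) p volume)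
        (_ : MemLp (fun x => φ x * iteratedDeriv 2 (u 0) x) p volume)
        (_ : MemLp (fun x => φ x * ρ 0 x) p volume)
        (_ : MemLp (fun x => φ x * deriv (ρ 0) x) p volume),
        ∀ t ∈ TwoCH.timeInterval T,
          TwoCH.weightedNorm φ p (u t) (ρ t) ≤
            EReal.exp ((C : EReal) * (TwoCH.supBound T u ρ : EReal) * (t : EReal)) *
              TwoCH.weightedNorm φ p (u 0) (ρ 0) := by
  obtain ⟨A, hA, hd⟩ := hφ.deriv_le
  obtain ⟨v, -, ⟨c, hc, hφv⟩, ⟨δ, hδ, hvδ⟩, hv⟩ := hφ.moderate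
  -- every `min (φ x) N` is moderate with the constant `c + 1 / δ`
  set κ := (c + 1 / δ) / 2 * ∫ x, v x * Real.exp (-|x|) with hκd
  have hκ : 0 ≤ κ := mul_nonneg (by positivity)
    (integral_nonneg fun x => mul_nonneg (hδ.le.trans (hvδ x)) (Real.exp_pos _).le)
  have hd' : ∀ᵐ x, |deriv φ x| ≤ A * φ x := hd.mono fun x hx => by rwa [abs_of_pos (hφ.pos x)] at hx
  refine ⟨A + 1 + 5 * (6 + κ), by positivity, ?_⟩
  intro s hs p hp T _ u ρ h _ _ _ _ _ t ht
  obtain ⟨M, hM0, hMsup, hM⟩ := h.exists_bound hs ht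
  have hexp : ENNReal.ofReal (Real.exp ((A + 1 + 5 * (6 + κ)) * M * t)) ≤
      EReal.exp (((A + 1 + 5 * (6 + κ) : ℝ) : EReal) * (TwoCH.supBound T u ρ : EReal) * (t : EReal)) := by
    rw [← EReal.exp_coe]
    refine EReal.exp_monotone ?_
    rw [EReal.coe_mul, EReal.coe_mul]
    have hMs : (M : EReal) ≤ (TwoCH.supBound T u ρ : EReal) := by
      have := EReal.coe_ennreal_le_coe_ennreal_iff.2 hMsup
      rwa [EReal.coe_ennreal_ofReal, max_eq_left hM0] at this
    exact mul_le_mul_of_nonneg_right (mul_le_mul_of_nonneg_left hMs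
      (EReal.coe_nonneg.2 (by positivity))) (EReal.coe_nonneg.2 ht.1)
  rw [TwoCH.weightedNorm_eq_sum, TwoCH.weightedNorm_eq_sum]
  have hcont : Continuous φ := TwoCH.continuous_of_ac hφ.locallyAbsolutelyContinuous
  have hmin : ∀ (n : ℕ) x, 0 ≤ min (φ x) ((n : ℝ) + 1) := fun n x =>
    le_min (hφ.pos x).le (by positivity)
  calc ∑ i, eLpNorm (fun x => φ x * TwoCH.fields u ρ i t x) p volume
      ≤ ∑ i, ⨆ n : ℕ, eLpNorm (fun x => min (φ x) (n + 1) * TwoCH.fields u ρ i t x) p volume :=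
        Finset.sum_le_sum fun i _ => by
          obtain ⟨σ, -, hσ⟩ := h.contHs_fields hs i
          exact TwoCH.eLpNorm_mul_le_iSup_min hcont (hσ.continuous t ht) p
    _ = ⨆ n : ℕ, ∑ i, eLpNorm (fun x => min (φ x) (n + 1) * TwoCH.fields u ρ i t x) p volume :=
        ENNReal.finsetSum_iSup_of_monotone fun i m n hmn =>
          TwoCH.eLpNorm_mul_mono (hmin m) (fun x => min_le_min le_rfl (by gcongr)) p
    _ ≤ _ := iSup_le fun n => ?_
  refine (h.sum_eLpNorm_le hs hA.le hp
    (TwoCH.isBoundedWeight_min hA hφ.pos hφ.locallyAbsolutelyContinuous hd' (by positivity)) hv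
    (TwoCH.moderate_min hφ.pos hδ hvδ hc hφv (by positivity)) hκ ht hM).trans ?_
  refine mul_le_mul' hexp (Finset.sum_le_sum fun i _ => ?_)
  exact TwoCH.eLpNorm_mul_mono (hmin n) (fun x => min_le_left _ _) p
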